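/- Hyperbolic space $\mathbb H^3$ is the hyperboloid model. A convex polyhedron is a compact intersection of finitely many closed half-spaces that is not contained in a plane, its faces are its two-dimensional faces, and the exterior dihedral angle at an edge is the angle between the outward unit normals of the two faces meeting there ($\pi$ minus the interior dihedral angle). **Theorem.** There is an absolute constant $\rho_0$ such that the following holds for every convex polyhedron $X\subset\mathbb H^3$ with $N$ vertices and diameter $\rho>\rho_0$. There are points $u,v\in X$ with $d(u,v)=\rho$ and a plane $P$ orthogonal to the segment $[u,v]$, separating $u$ from $v$ and at distance at least $\rho/(2N)$ from every vertex of $X$, such that the faces of $X$ that meet $P$ can be arranged in a cyclic sequence of $k\ge 3$ pairwise distinct faces $F_1,\dots,F_k$ (indices mod $k$) with the following properties: for every $i$ the intersection $e_i=F_i\cap F_{i+1}$ is an edge of $X$; the edges $e_1,\dots,e_k$ are exactly the edges of $X$ that meet $P$; and, if $\theta_i$ denotes the exterior dihedral angle of $X$ at $e_i$, then $$\sum_{i=1}^k\theta_i \;<\; 2\pi+12\,N\exp\!\left(-\frac{\rho}{2N}\right).$$ -/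

import Mathlib

noncomputable section

namespace HypThree

/-- The ambient space of the hyperboloid model. -/
abbrev Vec : Type := Fin 4 → ℝ

/-- The Minkowski scalar product on `ℝ⁴`, with the time coordinate listed first. -/
def form (x y : Vec) : ℝ :=
  -(x 0 * y 0) + x 1 * y 1 + x 2 * y 2 + x 3 * y 3

/-- Hyperbolic `3`-space: the upper sheet of the hyperboloid `⟨x, x⟩ = -1`. -/
def space : Set Vec := {x | form x x = -1 ∧ 0 < x 0}

/-- The hyperbolic distance, `cosh d(x, y) = -⟨x, y⟩`. -/
def hdist (x y : Vec) : ℝ := Real.arcosh (-form x y)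

/-- The hyperbolic diameter of a subset of hyperbolic space. -/
def hdiam (X : Set Vec) : ℝ := sSup {r | ∃ x ∈ X, ∃ y ∈ X, r = hdist x y}

/-- The totally geodesic plane with unit (spacelike) normal `n`. -/
def plane (n : Vec) : Set Vec := {x ∈ space | form n x = 0}

/-- The closed half-space bounded by `plane n`, with outward normal `n`. -/
def halfSpace (n : Vec) : Set Vec := {x ∈ space | form n x ≤ 0}

/-- A (compact, non-degenerate) convex polyhedron in hyperbolic `3`-space: a compact set which is
the intersection of finitely many closed half-spaces and is not contained in a plane. -/
structure IsConvexPolyhedron (X : Set Vec) : Prop where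
  compact : IsCompact X
  nondegenerate : Submodule.span ℝ X = ⊤
  halfSpaces : ∃ S : Set Vec, S.Finite ∧ (∀ n ∈ S, form n n = 1) ∧
    X = {x ∈ space | ∀ n ∈ S, form n x ≤ 0}

/-- `n` is a unit normal of a plane supporting `X` along `F`, pointing away from `X`. -/
structure IsOutwardNormal (X F : Set Vec) (n : Vec) : Prop where
  unit : form n n = 1
  supports : X ⊆ halfSpace n
  contact : F = X ∩ plane n

/-- `F` is a `d`-dimensional proper face of `X` (`d = 0, 1, 2`): the intersection of `X` with a
supporting plane, spanning a `(d + 1)`-dimensional linear subspace of `ℝ⁴`, which means that the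
smallest totally geodesic subspace containing `F` has dimension `d`. -/
def IsFaceOfDim (X : Set Vec) (d : ℕ) (F : Set Vec) : Prop :=
  (∃ n, IsOutwardNormal X F n) ∧ Module.finrank ℝ (Submodule.span ℝ F) = d + 1

/-- The vertices of `X`. -/
def vertices (X : Set Vec) : Set Vec := {v | IsFaceOfDim X 0 {v}}

/-- `e` is an edge of `X`. -/
def IsEdge (X e : Set Vec) : Prop := IsFaceOfDim X 1 e

/-- `F` is a (two-dimensional) face of `X`. -/
def IsFace (X F : Set Vec) : Prop := IsFaceOfDim X 2 F

open Classical in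
/-- The outward unit normal of the face `F` of `X`
(unique by `IsOutwardNormal.unique` when `F` is a two-dimensional face). -/
def outwardNormal (X F : Set Vec) : Vec :=
  if h : ∃ n, IsOutwardNormal X F n then h.choose else 0

/-- The exterior dihedral angle of `X` at the common edge of the faces `F` and `G`: the angle
between the outward unit normals, that is, `π` minus the interior dihedral angle. -/
def exteriorDihedralAngle (X F G : Set Vec) : ℝ :=
  Real.arccos (form (outwardNormal X F) (outwardNormal X G))

/-- The Minkowski scalar product as a bilinear form. -/
def bilin : LinearMap.BilinForm ℝ Vec :=
  LinearMap.mk₂ ℝ form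
    (by intros; simp [form]; ring) (by intros; simp [form]; ring)
    (by intros; simp [form]; ring) (by intros; simp [form]; ring)

/-- A two-dimensional face of a convex polyhedron has only one outward unit normal. -/
theorem IsOutwardNormal.unique {X F : Set Vec} (hX : IsConvexPolyhedron X) (hF : IsFace X F)
    {m n : Vec} (hm : IsOutwardNormal X F m) (hn : IsOutwardNormal X F n) : m = n := by
  have key : ∀ p, IsOutwardNormal X F p →
      bilin p ∈ (Submodule.span ℝ F).dualAnnihilator := by
    intro p hp
    rw [Submodule.mem_dualAnnihilator]
    intro w hw
    have hle : Submodule.span ℝ F ≤ LinearMap.ker (bilin p) := by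
      rw [Submodule.span_le]
      intro x hx
      rw [hp.contact] at hx
      exact hx.2.2
    exact hle hw
  have hdim : Module.finrank ℝ (Submodule.span ℝ F).dualAnnihilator = 1 := by
    have h1 := Subspace.finrank_add_finrank_dualAnnihilator_eq (K := ℝ) (Submodule.span ℝ F)
    have h2 := hF.2
    have h3 : Module.finrank ℝ Vec = 4 := by simp
    omega
  have hn0 : (⟨bilin n, key n hn⟩ : (Submodule.span ℝ F).dualAnnihilator) ≠ 0 := by
    intro h
    have h' : bilin n = 0 := congrArg Subtype.val h
    have h2 : form n n = 0 := LinearMap.congr_fun h' n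
    linarith [hn.unit]
  have hone := (finrank_eq_one_iff_of_nonzero' (K := ℝ)
    (V := (Submodule.span ℝ F).dualAnnihilator) _ hn0).1 hdim
  obtain ⟨c, hc⟩ := hone ⟨bilin m, key m hm⟩
  have hc' : ∀ x, c * form n x = form m x := fun x =>
    LinearMap.congr_fun (congrArg Subtype.val hc) x
  have hval : m = c • n := by
    ext i
    have h := hc' (Pi.single i 1)
    fin_cases i <;> simp [form] at h ⊢ <;> linarith
  have hcc : c * c = 1 := by
    have h1 := hc' m
    have h2 := hc' n
    have h3 : form n m = form m n := by simp [form]; ring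
    rw [hm.unit, h3, ← h2, hn.unit] at h1
    linarith
  rcases mul_self_eq_one_iff.1 hcc with h | h
  · rw [hval, h, one_smul]
  · exfalso
    have hle : Submodule.span ℝ X ≤ LinearMap.ker (bilin n) := by
      rw [Submodule.span_le]
      intro x hx
      have h1 := (hm.supports hx).2
      have h2 := (hn.supports hx).2
      have h3 := hc' x
      rw [h] at h3
      change form n x = 0
      linarith
    rw [hX.nondegenerate] at hle
    have h2 : form n n = 0 := hle (Submodule.mem_top (x := n))
    linarith [hn.unit]

theorem outwardNormal_spec {X F : Set Vec} (h : ∃ n, IsOutwardNormal X F n) :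
    IsOutwardNormal X F (outwardNormal X F) := by
  unfold outwardNormal
  rw [dif_pos h]
  exact h.choose_spec

end HypThree

end

/-!
The diameter of `X` is attained at two points `u` and `v`.  The projections of the `N` vertices to
the line through `u` and `v` leave a gap of length `ρ / N` between `u` and `v`
(`exists_gap`), and the plane `P` orthogonal to the line in the middle of this gap
satisfies the requirements on the position of `P` (`IsPresentation.exists_isFarPlane`): all
vertices lie in the two half-spaces at distance `r = ρ / (2N)` from `P`, measured along the line.

Let `T = tanh r`.  The polyhedron being the hull of its vertices
(`IsPresentation.exists_vertex_nonpos`), the section of `X` by `P` lies in a disk of radius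
`arcosh (1 / T)` (`IsFarPlane.sq_mul_form_sq_le`), and a face that meets `P` has vertices on both
sides of `P`, which makes it almost orthogonal to `P`: the scalar product of the unit normals is at
most `√(1 - T²)` in absolute value (`IsFarPlane.form_sq_le`).

Fix an interior point `p` of the section and project the normals of the faces that meet `P` to the
tangent plane of `P` at `p`.  Ordered by the directions of these projections, the faces form the
cyclic sequence: in the projective model centred at `p` the section is a bounded convex polygon, and
two of its sides meet precisely if their normal directions are adjacent
(`IsCyclicOrder.exists_corner`, `IsCyclicOrder.exists_consecutive`).  The turning angles between
consecutive directions add up to exactly `2π`, so no Gauss–Bonnet formula is needed.  At a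
common point `y` of two consecutive faces, the parallel transport of each direction from `p` to `y`
makes an angle of at most `γ = arccos (T² √(2 - T²))` with the normal of its face
(`SectionFrame.le_form_transport`), so that the dihedral angle exceeds the turning angle by at
most `2γ`, by the triangle inequality for angles in the Euclidean tangent space at `y`.

It remains to count.  A polyhedron with `N` vertices has at most `2N` faces
(`IsPresentation.card_le`); this follows without Euler's formula, from the observation that each
face has a vertex of intermediate height and that a plane through a vertex properly crosses at most
two of the faces there.  If `3 exp (-r) < π / 2` then `γ < 3 exp (-r)` and the total error is less
than `2N · 6 exp (-r)`; otherwise `12 N exp (-r) ≥ 2πN`, and the bound holds because each of the at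
most `2N` angles is at most `π`.  In particular every `ρ > 0` is allowed.
-/

noncomputable section

namespace HypThree

/-! ### The Minkowski scalar product -/

theorem form_comm (x y : Vec) : form x y = form y x := by simp only [form]; ring

@[simp] theorem form_add_left (x y z : Vec) : form (x + y) z = form x z + form y z := by
  simp only [form, Pi.add_apply]; ring

@[simp] theorem form_add_right (x y z : Vec) : form x (y + z) = form x y + form x z := by
  simp only [form, Pi.add_apply]; ring

@[simp] theorem form_smul_left (c : ℝ) (x y : Vec) : form (c • x) y = c * form x y := by
  simp only [form, Pi.smul_apply, smul_eq_mul]; ring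

@[simp] theorem form_smul_right (c : ℝ) (x y : Vec) : form x (c • y) = c * form x y := by
  simp only [form, Pi.smul_apply, smul_eq_mul]; ring

@[simp] theorem form_zero_left (x : Vec) : form 0 x = 0 := by simp [form]

@[simp] theorem form_zero_right (x : Vec) : form x 0 = 0 := by simp [form]

@[simp] theorem form_neg_left (x y : Vec) : form (-x) y = -form x y := by
  simp only [form, Pi.neg_apply]; ring

@[simp] theorem form_neg_right (x y : Vec) : form x (-y) = -form x y := by
  simp only [form, Pi.neg_apply]; ring

@[simp] theorem form_sub_left (x y z : Vec) : form (x - y) z = form x z - form y z := by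
  simp only [form, Pi.sub_apply]; ring

@[simp] theorem form_sub_right (x y z : Vec) : form x (y - z) = form x y - form x z := by
  simp only [form, Pi.sub_apply]; ring

theorem form_sum_left {ι : Type*} (t : Finset ι) (f : ι → Vec) (x : Vec) :
    form (∑ i ∈ t, f i) x = ∑ i ∈ t, form (f i) x := by
  classical
  induction t using Finset.induction_on with
  | empty => simp
  | insert a t ha ih => rw [Finset.sum_insert ha, Finset.sum_insert ha, form_add_left, ih]

theorem form_sum_right {ι : Type*} (t : Finset ι) (f : ι → Vec) (x : Vec) :
    form x (∑ i ∈ t, f i) = ∑ i ∈ t, form x (f i) := by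
  simp only [form_comm x, form_sum_left]

theorem continuous_form (n : Vec) : Continuous (form n) := by
  unfold form; fun_prop

theorem continuous_form_self : Continuous fun x : Vec => form x x := by
  unfold form; fun_prop

/-- The Minkowski scalar product is non-degenerate. -/
theorem eq_of_form_eq {x y : Vec} (h : ∀ z, form x z = form y z) : x = y := by
  ext i
  have h := h (Pi.single i 1)
  fin_cases i <;> simpa [form] using h

/-- The orthogonal complement of a vector. -/
def orth (n : Vec) : Submodule ℝ Vec := LinearMap.ker (bilin n)

@[simp] theorem mem_orth {n x : Vec} : x ∈ orth n ↔ form n x = 0 := Iff.rfl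

theorem bilin_apply (x y : Vec) : bilin x y = form x y := rfl

theorem finrank_orth {n : Vec} (hn : n ≠ 0) : Module.finrank ℝ (orth n) = 3 := by
  have h0 : bilin n ≠ 0 := fun h =>
    hn (eq_of_form_eq fun z => by simpa [bilin_apply] using LinearMap.congr_fun h z)
  have h1 := Module.Dual.finrank_ker_add_one_of_ne_zero (f := bilin n) h0
  have h2 : Module.finrank ℝ Vec = 4 := by simp
  have h3 : Module.finrank ℝ (orth n) = Module.finrank ℝ (LinearMap.ker (bilin n)) := rfl
  omega

/-! ### Isometries with Euclidean space -/

/-- The Lorentz boost taking the point `y` of hyperbolic space to the origin of the hyperboloid,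
followed by the projection to the three space coordinates.  It restricts to an isometry of the
orthogonal complement of `y` with Euclidean three-space. -/
def spatial (y : Vec) : Vec →ₗ[ℝ] EuclideanSpace ℝ (Fin 3) where
  toFun x := WithLp.toLp 2 fun j => x j.succ - x 0 / (1 + y 0) * y j.succ
  map_add' a b := by ext j; simp; ring
  map_smul' a b := by ext j; simp; ring

theorem inner_spatial {y a b : Vec} (hy : y ∈ space) (ha : form y a = 0) (hb : form y b = 0) :
    inner ℝ (spatial y a) (spatial y b) = form a b := by
  obtain ⟨h1, h2⟩ := hy
  have h3 : 1 + y 0 ≠ 0 := by positivity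
  simp only [spatial, form, LinearMap.coe_mk, AddHom.coe_mk, PiLp.inner_apply,
    Fin.sum_univ_three, RCLike.inner_apply, conj_trivial] at *
  simp only [Fin.succ_zero_eq_one, Fin.succ_one_eq_two, show Fin.succ (2 : Fin 3) = 3 from rfl]
  have e1 : y 1 * a 1 + y 2 * a 2 + y 3 * a 3 = y 0 * a 0 := by linarith
  have e2 : y 1 * b 1 + y 2 * b 2 + y 3 * b 3 = y 0 * b 0 := by linarith
  have e3 : y 1 * y 1 + y 2 * y 2 + y 3 * y 3 = y 0 * y 0 - 1 := by linarith
  set α := a 0 / (1 + y 0) with hα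
  set β := b 0 / (1 + y 0) with hβ
  have ea : a 0 = α * (1 + y 0) := by rw [hα]; field_simp
  have eb : b 0 = β * (1 + y 0) := by rw [hβ]; field_simp
  rw [ea] at e1 ⊢
  rw [eb] at e2 ⊢
  linear_combination (-β) * e1 + (-α) * e2 + α * β * e3

theorem form_self_nonneg_of_orth {y a : Vec} (hy : y ∈ space) (ha : form y a = 0) :
    0 ≤ form a a := by
  rw [← inner_spatial hy ha ha]; exact real_inner_self_nonneg

theorem eq_zero_of_spatial_eq_zero {y a : Vec} (hy : y ∈ space) (ha : form y a = 0)
    (h : spatial y a = 0) : a = 0 := by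
  obtain ⟨h1, h2⟩ := hy
  have h3 : 1 + y 0 ≠ 0 := by positivity
  set α := a 0 / (1 + y 0) with hα
  have e : ∀ j : Fin 3, a j.succ = α * y j.succ := by
    intro j
    have := congrArg (fun v : EuclideanSpace ℝ (Fin 3) => v j) h
    simp only [spatial, LinearMap.coe_mk, AddHom.coe_mk, PiLp.zero_apply] at this
    rw [hα]; linarith
  have ea : a 0 = α * (1 + y 0) := by rw [hα]; field_simp
  have e1 := e 0
  have e2 := e 1
  have e3 := e 2
  simp only [Fin.succ_zero_eq_one, Fin.succ_one_eq_two, show Fin.succ (2 : Fin 3) = 3 from rfl]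
    at e1 e2 e3
  have : α = 0 := by
    simp only [form, ea, e1, e2, e3] at ha h1
    have : -α * (1 + y 0) = 0 := by linear_combination ha - α * h1
    simpa [h3] using this
  ext i
  fin_cases i <;> simp [ea, e1, e2, e3, this]

theorem form_self_pos_of_orth {y a : Vec} (hy : y ∈ space) (ha : form y a = 0) (h0 : a ≠ 0) :
    0 < form a a := by
  rw [← inner_spatial hy ha ha]
  exact real_inner_self_pos.2 fun h => h0 (eq_zero_of_spatial_eq_zero hy ha h)

/-- The Cauchy–Schwarz inequality in the (Euclidean) tangent space at a point. -/
theorem form_sq_le_of_orth {y a b : Vec} (hy : y ∈ space) (ha : form y a = 0)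
    (hb : form y b = 0) : form a b ^ 2 ≤ form a a * form b b := by
  rw [← inner_spatial hy ha ha, ← inner_spatial hy ha hb, ← inner_spatial hy hb hb, sq]
  exact real_inner_mul_inner_self_le _ _

/-- The triangle inequality for angles between unit tangent vectors at a point. -/
theorem arccos_form_le {y a b c : Vec} (hy : y ∈ space) (ha : form y a = 0) (hb : form y b = 0)
    (hc : form y c = 0) (ha1 : form a a = 1) (hb1 : form b b = 1) (hc1 : form c c = 1) :
    Real.arccos (form a c) ≤ Real.arccos (form a b) + Real.arccos (form b c) := by
  have hn : ∀ x, form y x = 0 → form x x = 1 → ‖spatial y x‖ = 1 := by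
    intro x hx hx1
    rw [← inner_spatial hy hx hx, real_inner_self_eq_norm_sq] at hx1
    nlinarith [norm_nonneg (spatial y x)]
  have hang : ∀ x z, form y x = 0 → form x x = 1 → form y z = 0 → form z z = 1 →
      InnerProductGeometry.angle (spatial y x) (spatial y z) = Real.arccos (form x z) := by
    intro x z hx hx1 hz hz1
    rw [InnerProductGeometry.angle, hn x hx hx1, hn z hz hz1, inner_spatial hy hx hz]
    simp
  rw [← hang a c ha ha1 hc hc1, ← hang a b ha ha1 hb hb1, ← hang b c hb hb1 hc hc1]
  exact InnerProductGeometry.angle_le_angle_add_angle _ _ _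

/-- A unit tangent vector at a point of hyperbolic space extends to an orthonormal frame; this is
recorded through the resulting expansion of the scalar product. -/
theorem exists_frame {p n : Vec} (hp : p ∈ space) (hn : form n n = 1) (hpn : form p n = 0) :
    ∃ a b : Vec, form p a = 0 ∧ form p b = 0 ∧ form n a = 0 ∧ form n b = 0 ∧
      form a a = 1 ∧ form b b = 1 ∧ form a b = 0 ∧
      ∀ x y, form x y = -(form p x * form p y) + form n x * form n y + form a x * form a y +
        form b x * form b y := by
  obtain ⟨hp1, hp2⟩ := id hp
  -- the Householder reflection exchanging `p` with the opposite of the origin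
  let e : Vec := Pi.single 0 1
  have he : ∀ x, form e x = -x 0 := fun x => by simp [e, form]
  have hD : 1 + p 0 ≠ 0 := by positivity
  let R : Vec → Vec := fun x => x + ((form (p + e) x) / (1 + p 0)) • (p + e)
  have hR : ∀ x y, form (R x) (R y) = form x y := by
    intro x y
    have hpe : form p e = -p 0 := by rw [form_comm, he]
    have hee : form e e = -1 := by rw [he]; simp [e]
    simp only [R, form_add_left, form_add_right, form_smul_left, form_smul_right, hp1, hpe,
      he p, hee, form_comm x]
    field_simp
    ring
  have hRR : ∀ x, R (R x) = x := by
    intro x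
    have hpe : form p e = -p 0 := by rw [form_comm, he]
    have hee : form e e = -1 := by rw [he]; simp [e]
    have : form (p + e) (R x) = -form (p + e) x := by
      simp only [R, form_add_left, form_add_right, form_smul_right, hp1, hpe,
        he p, hee]
      field_simp
      ring
    change R x + ((form (p + e) (R x)) / (1 + p 0)) • (p + e) = x
    rw [this]
    simp only [R]
    module
  have hRadj : ∀ x y, form (R x) y = form x (R y) := fun x y => by
    rw [← hR x (R y), hRR]
  have hR0 : ∀ x, (R x) 0 = form p x := by
    intro x
    have : R e = -p := by
      have : form (p + e) e = -(1 + p 0) := by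
        rw [form_add_left, form_comm, he, he]; simp [e]
      simp only [R, this, neg_div, div_self hD]
      module
    have h1 := he (R x)
    rw [← hRadj, this, form_neg_left] at h1
    linarith
  let σ : Vec → EuclideanSpace ℝ (Fin 3) := fun x => WithLp.toLp 2 fun j => x j.succ
  have hσ : ∀ x y : Vec, inner ℝ (σ x) (σ y) = form x y + x 0 * y 0 := by
    intro x y
    simp only [σ, form, PiLp.inner_apply, Fin.sum_univ_three, RCLike.inner_apply, conj_trivial,
      Fin.succ_zero_eq_one, Fin.succ_one_eq_two, show Fin.succ (2 : Fin 3) = 3 from rfl]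
    ring
  let lift : EuclideanSpace ℝ (Fin 3) → Vec := fun v => Fin.cons 0 v
  have hlift : ∀ v, σ (lift v) = v := by intro v; ext j; simp [σ, lift]
  have hlift0 : ∀ v, lift v 0 = 0 := by intro v; simp [lift]
  have hn1 : (inner ℝ (σ (R n)) (σ (R n)) : ℝ) = 1 := by
    rw [hσ, hR, hR0, hpn, hn]; ring
  have hnorm : ‖σ (R n)‖ = 1 := by
    rw [real_inner_self_eq_norm_sq] at hn1
    nlinarith [norm_nonneg (σ (R n))]
  obtain ⟨B, hB⟩ := Orthonormal.exists_orthonormalBasis_extension_of_card_eq (𝕜 := ℝ)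
    (E := EuclideanSpace ℝ (Fin 3)) (ι := Fin 3) (by simp) (v := fun _ => σ (R n)) (s := {0})
    (by
      constructor
      · rintro ⟨i, hi⟩; simpa using hnorm
      · rintro ⟨i, hi⟩ ⟨j, hj⟩ hij
        exact absurd (Subtype.ext (hi.trans hj.symm)) hij)
  have hB0 : B 0 = σ (R n) := hB 0 rfl
  have key : ∀ j x, form (R (lift (B j))) x = inner ℝ (B j) (σ (R x)) := by
    intro j x
    have := hσ (lift (B j)) (R x)
    rw [hlift, hlift0, zero_mul, add_zero] at this
    rw [this, hRadj]
  have keyn : ∀ x, form n x = inner ℝ (B 0) (σ (R x)) := by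
    intro x
    rw [hB0, hσ, hR, hR0, hpn]; ring
  have hpl : ∀ j, form p (R (lift (B j))) = 0 := by
    intro j; rw [← hR0, hRR, hlift0]
  have hσσ : ∀ j, σ (R (R (lift (B j)))) = B j := by intro j; rw [hRR, hlift]
  have hon : ∀ i j, inner ℝ (B i) (B j) = if i = j then (1 : ℝ) else 0 :=
    fun i j => OrthonormalBasis.inner_eq_ite B i j
  refine ⟨R (lift (B 1)), R (lift (B 2)), hpl 1, hpl 2, ?_, ?_, ?_, ?_, ?_, ?_⟩
  · rw [keyn, hσσ, hon]; simp
  · rw [keyn, hσσ, hon]; simp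
  · rw [key, hσσ, hon]; simp
  · rw [key, hσσ, hon]; simp
  · rw [key, hσσ, hon]; simp
  · intro x y
    have h := B.sum_inner_mul_inner (σ (R x)) (σ (R y))
    rw [hσ, hR, hR0, hR0, Fin.sum_univ_three] at h
    rw [key, key, key, key, keyn x, keyn y,
      real_inner_comm (σ (R x)), real_inner_comm (σ (R x)), real_inner_comm (σ (R x))]
    linarith

/-! ### The future cone -/

/-- The open cone of future timelike vectors. -/
def future : Set Vec := {x | form x x < 0 ∧ 0 < x 0}

theorem space_subset_future : space ⊆ future := fun x hx => ⟨by rw [hx.1]; norm_num, hx.2⟩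

theorem isOpen_future : IsOpen future :=
  (isOpen_lt continuous_form_self continuous_const).inter
    (isOpen_lt continuous_const (continuous_apply 0))

theorem form_neg_of_future {x y : Vec} (hx : x ∈ future) (hy : y ∈ future) : form x y < 0 := by
  obtain ⟨h1, h2⟩ := hx
  obtain ⟨h3, h4⟩ := hy
  simp only [form] at *
  have hpos : 0 < x 0 * y 0 := mul_pos h2 h4
  have h : (x 1 * y 1 + x 2 * y 2 + x 3 * y 3) ^ 2 < (x 0 * y 0) ^ 2 := by
    have hx2 : x 1 ^ 2 + x 2 ^ 2 + x 3 ^ 2 < x 0 ^ 2 := by nlinarith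
    have hy2 : y 1 ^ 2 + y 2 ^ 2 + y 3 ^ 2 < y 0 ^ 2 := by nlinarith
    calc (x 1 * y 1 + x 2 * y 2 + x 3 * y 3) ^ 2
        ≤ (x 1 ^ 2 + x 2 ^ 2 + x 3 ^ 2) * (y 1 ^ 2 + y 2 ^ 2 + y 3 ^ 2) := by
          nlinarith [sq_nonneg (x 1 * y 2 - x 2 * y 1), sq_nonneg (x 1 * y 3 - x 3 * y 1),
            sq_nonneg (x 2 * y 3 - x 3 * y 2)]
      _ ≤ (x 1 ^ 2 + x 2 ^ 2 + x 3 ^ 2) * y 0 ^ 2 := by gcongr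
      _ < x 0 ^ 2 * y 0 ^ 2 := by gcongr
      _ = (x 0 * y 0) ^ 2 := by ring
  have := abs_lt_of_sq_lt_sq h hpos.le
  linarith [(abs_lt.1 this).2]

theorem future_add {x y : Vec} (hx : x ∈ future) (hy : y ∈ future) : x + y ∈ future := by
  have h := form_neg_of_future hx hy
  refine ⟨?_, add_pos hx.2 hy.2⟩
  have h' := form_comm x y
  simp only [form_add_left, form_add_right]
  linarith [hx.1, hy.1]

theorem future_smul {x : Vec} (hx : x ∈ future) {c : ℝ} (hc : 0 < c) : c • x ∈ future := by
  refine ⟨?_, mul_pos hc hx.2⟩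
  simp only [form_smul_left, form_smul_right]
  have := hx.1
  have : 0 < c * (c * -form x x) := by
    have : 0 < -form x x := by linarith
    positivity
  linarith

theorem ne_zero_of_future {x : Vec} (hx : x ∈ future) : x ≠ 0 := by
  rintro rfl; exact lt_irrefl _ (hx.2)

theorem form_neg_of_space {x y : Vec} (hx : x ∈ space) (hy : y ∈ space) : form x y < 0 :=
  form_neg_of_future (space_subset_future hx) (space_subset_future hy)

/-- Central projection of a future timelike vector to hyperbolic space. -/
theorem exists_smul_mem_space {x : Vec} (hx : x ∈ future) : ∃ c : ℝ, 0 < c ∧ c • x ∈ space := by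
  have h : 0 < -form x x := by linarith [hx.1]
  have hs := Real.sqrt_pos.2 h
  refine ⟨(Real.sqrt (-form x x))⁻¹, by positivity, ?_, mul_pos (by positivity) hx.2⟩
  simp only [form_smul_left, form_smul_right]
  have := Real.mul_self_sqrt h.le
  field_simp
  linarith

theorem form_le_neg_one {x y : Vec} (hx : x ∈ space) (hy : y ∈ space) : form x y ≤ -1 := by
  have h := form_neg_of_space hx hy
  have hz : form x (y + form x y • x) = 0 := by
    simp only [form_add_right, form_smul_right, hx.1]; ring
  have h2 := form_self_nonneg_of_orth hx hz
  simp only [form_add_right, form_add_left, form_smul_right, form_smul_left, hx.1, hy.1,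
    form_comm y x] at h2
  nlinarith

theorem eq_of_smul_mem_space {x : Vec} {c : ℝ} (hx : x ∈ space) (h : c • x ∈ space) : c = 1 := by
  have h1 := h.1
  have h2 : 0 < c * x 0 := h.2
  simp only [form_smul_left, form_smul_right, hx.1] at h1
  have h3 : 0 < c := pos_of_mul_pos_left h2 hx.2.le
  nlinarith

/-! ### Polyhedra presented by an irredundant system of inequalities -/

/-- The polyhedral cone in `ℝ⁴` cut out by the half-spaces with outward normals in `S`. -/
def polyCone (S : Finset Vec) : Set Vec := {x | ∀ n ∈ S, form n x ≤ 0}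

/-- `S` is an irredundant system of outward unit normals defining the polyhedron `X`: for each
`n ∈ S` some point violates only the inequality of `n`. -/
structure IsPresentation (X : Set Vec) (S : Finset Vec) : Prop where
  poly : IsConvexPolyhedron X
  unit : ∀ n ∈ S, form n n = 1
  eq : X = {x ∈ space | ∀ n ∈ S, form n x ≤ 0}
  irredundant : ∀ n ∈ S, ∃ x ∈ space, 0 < form n x ∧ ∀ m ∈ S, m ≠ n → form m x ≤ 0

theorem IsConvexPolyhedron.exists_presentation {X : Set Vec} (hX : IsConvexPolyhedron X) :
    ∃ S, IsPresentation X S := by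
  classical
  let Q : Finset Vec → Prop := fun S => (∀ n ∈ S, form n n = 1) ∧
    X = {x ∈ space | ∀ n ∈ S, form n x ≤ 0}
  have hQ : ∃ S, Q S := by
    obtain ⟨S, hS, h1, h2⟩ := hX.halfSpaces
    refine ⟨hS.toFinset, ?_, ?_⟩
    · simpa using h1
    · simpa using h2
  -- a system with the least number of inequalities is irredundant
  obtain ⟨S, hS, hmin⟩ := WellFounded.has_min (measure Finset.card).wf {S | Q S} hQ
  refine ⟨S, hX, hS.1, hS.2, fun n hn => ?_⟩
  by_contra hcon
  push Not at hcon
  refine hmin (S.erase n) ⟨fun m hm => hS.1 m (Finset.mem_of_mem_erase hm), ?_⟩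
    (Finset.card_erase_lt_of_mem hn)
  rw [hS.2]
  ext x
  refine ⟨fun hx => ⟨hx.1, fun m hm => hx.2 m (Finset.mem_of_mem_erase hm)⟩, fun hx => ⟨hx.1, ?_⟩⟩
  by_contra h2
  push Not at h2
  obtain ⟨m, hm, hmx⟩ := h2
  have hmn : m = n := by
    by_contra hne
    exact absurd (hx.2 m (Finset.mem_erase.2 ⟨hne, hm⟩)) (not_le.2 hmx)
  subst hmn
  obtain ⟨m', hm', hne, hpos⟩ := hcon x hx.1 hmx
  exact absurd (hx.2 m' (Finset.mem_erase.2 ⟨hne, hm'⟩)) (not_le.2 hpos)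

/-- The part of `X` on which all the inequalities of `A` are equalities. -/
def faceSet (X : Set Vec) (A : Set Vec) : Set Vec := {x ∈ X | ∀ n ∈ A, form n x = 0}

/-- The subspace on which all the linear forms of `A` vanish. -/
def orthSet (A : Set Vec) : Submodule ℝ Vec where
  carrier := {x | ∀ n ∈ A, form n x = 0}
  add_mem' := fun ha hb n hn => by rw [form_add_right, ha n hn, hb n hn, add_zero]
  zero_mem' := fun n _ => form_zero_right n
  smul_mem' := fun c x hx n hn => by rw [form_smul_right, hx n hn, mul_zero]

theorem mem_orthSet {A : Set Vec} {x : Vec} : x ∈ orthSet A ↔ ∀ n ∈ A, form n x = 0 := Iff.rfl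

theorem orthSet_singleton (n : Vec) : orthSet {n} = orth n := by
  ext x; simp [mem_orthSet]

theorem nonempty_of_isFaceOfDim {X : Set Vec} {d : ℕ} {G : Set Vec} (hG : IsFaceOfDim X d G) :
    G.Nonempty := by
  by_contra hne
  rw [Set.not_nonempty_iff_eq_empty] at hne
  have := hG.2
  rw [hne, Submodule.span_empty, finrank_bot] at this
  omega

theorem vertex_mem {X : Set Vec} {w : Vec} (hw : w ∈ vertices X) : w ∈ X := by
  obtain ⟨⟨m, hm⟩, -⟩ := hw
  have : w ∈ ({w} : Set Vec) := rfl
  rw [hm.contact] at this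
  exact this.1

/-- From a point of the cone, a ray that preserves the tight inequalities but leaves the cone
reaches a point where a further inequality is tight. -/
theorem exists_exit {S : Finset Vec} {x z : Vec} (hx : x ∈ polyCone S)
    (hz : z ∉ polyCone S) (hact : ∀ n ∈ S, form n x = 0 → form n z = 0) :
    ∃ t : ℝ, 0 < t ∧ x + t • z ∈ polyCone S ∧ ∃ n ∈ S, form n x ≠ 0 ∧ form n (x + t • z) = 0 := by
  classical
  let B := S.filter fun n => 0 < form n z
  have hB : B.Nonempty := by
    have hz' : ¬ ∀ n ∈ S, form n z ≤ 0 := hz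
    push Not at hz'
    obtain ⟨n, hn, hpos⟩ := hz'
    exact ⟨n, Finset.mem_filter.2 ⟨hn, hpos⟩⟩
  obtain ⟨n, hnB, hmin⟩ := B.exists_min_image (fun n => -form n x / form n z) hB
  obtain ⟨hn, hpos⟩ := Finset.mem_filter.1 hnB
  have hneg : form n x < 0 := lt_of_le_of_ne (hx n hn) fun h0 => by
    rw [hact n hn h0] at hpos; exact lt_irrefl _ hpos
  refine ⟨-form n x / form n z, div_pos (by linarith) hpos, fun m hm => ?_, n, hn, hneg.ne, ?_⟩
  · rw [form_add_right, form_smul_right]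
    rcases le_or_gt (form m z) 0 with hle | hgt
    · have h1 := hx m hm
      have h2 : 0 ≤ -form n x / form n z := (div_pos (by linarith) hpos).le
      have := mul_nonpos_of_nonneg_of_nonpos h2 hle
      linarith
    · have h1 := hmin m (Finset.mem_filter.2 ⟨hm, hgt⟩)
      have h2 : -form n x / form n z * form m z ≤ -form m x := by
        rwa [le_div_iff₀ hgt] at h1
      linarith
  · rw [form_add_right, form_smul_right, div_mul_cancel₀ _ hpos.ne']; ring

namespace IsPresentation

variable {X : Set Vec} {S : Finset Vec}

theorem mem_iff (h : IsPresentation X S) {x : Vec} : x ∈ X ↔ x ∈ space ∧ x ∈ polyCone S := by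
  conv_lhs => rw [h.eq]
  rfl

theorem subset_space (h : IsPresentation X S) : X ⊆ space := fun _ hx => (h.mem_iff.1 hx).1

theorem form_nonpos (h : IsPresentation X S) {n x : Vec} (hn : n ∈ S) (hx : x ∈ X) :
    form n x ≤ 0 := (h.mem_iff.1 hx).2 n hn

theorem nonempty (h : IsPresentation X S) : X.Nonempty := by
  by_contra hne
  rw [Set.not_nonempty_iff_eq_empty] at hne
  have := h.poly.nondegenerate
  rw [hne, Submodule.span_empty] at this
  exact bot_ne_top this

theorem exists_form_ne (h : IsPresentation X S) {n : Vec} (hn : n ≠ 0) :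
    ∃ x ∈ X, form n x ≠ 0 := by
  by_contra hcon
  push Not at hcon
  have hle : Submodule.span ℝ X ≤ orth n := Submodule.span_le.2 fun x hx => hcon x hx
  rw [h.poly.nondegenerate] at hle
  exact hn (eq_of_form_eq fun z => by simpa using hle (Submodule.mem_top (x := z)))

theorem ne_zero (h : IsPresentation X S) {n : Vec} (hn : n ∈ S) : n ≠ 0 := by
  rintro rfl
  simpa using h.unit _ hn

/-- A polyhedron has interior points. -/
theorem exists_interior (h : IsPresentation X S) : ∃ p ∈ X, ∀ n ∈ S, form n p < 0 := by
  classical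
  have h1 : ∀ n : Vec, ∃ x ∈ X, n ∈ S → form n x < 0 := by
    intro n
    by_cases hn : n ∈ S
    · obtain ⟨x, hx, hne⟩ := h.exists_form_ne (h.ne_zero hn)
      exact ⟨x, hx, fun _ => lt_of_le_of_ne (h.form_nonpos hn hx) hne⟩
    · obtain ⟨x, hx⟩ := h.nonempty
      exact ⟨x, hx, fun h => absurd h hn⟩
  choose f hf hneg using h1
  obtain ⟨x₀, hx₀⟩ := h.nonempty
  have hfut : ∀ t : Finset Vec, x₀ + ∑ n ∈ t, f n ∈ future := by
    intro t
    induction t using Finset.induction_on with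
    | empty => simpa using space_subset_future (h.subset_space hx₀)
    | insert a t ha ih =>
      rw [Finset.sum_insert ha, add_left_comm]
      exact future_add (space_subset_future (h.subset_space (hf a))) ih
  obtain ⟨c, hc, hcs⟩ := exists_smul_mem_space (hfut S)
  have hlt : ∀ n ∈ S, form n (c • (x₀ + ∑ n ∈ S, f n)) < 0 := by
    intro n hn
    rw [form_smul_right, form_add_right, form_sum_right]
    have h2 : ∑ m ∈ S, form n (f m) < 0 :=
      Finset.sum_neg' (fun m _ => h.form_nonpos hn (hf m)) ⟨n, hn, hneg n hn⟩
    have h3 := h.form_nonpos hn hx₀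
    exact mul_neg_of_pos_of_neg hc (by linarith)
  exact ⟨_, h.mem_iff.2 ⟨hcs, fun n hn => (hlt n hn).le⟩, hlt⟩

/-- Since the polyhedron is compact, its cone stays inside the future cone. -/
theorem mem_future (h : IsPresentation X S) {x : Vec} (hx : x ∈ polyCone S) (hx0 : x ≠ 0) :
    x ∈ future := by
  obtain ⟨M, hM⟩ : ∃ M : ℝ, ∀ y ∈ X, y 0 ≤ M := by
    obtain ⟨M, hM⟩ := (h.poly.compact.image (continuous_apply (0 : Fin 4))).bddAbove
    exact ⟨M, fun y hy => hM ⟨y, hy, rfl⟩⟩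
  -- the compactness of `X` confines the future points of the cone to a narrower closed cone
  let C : Set Vec := {y | 0 ≤ y 0 ∧ y 0 ^ 2 ≤ M ^ 2 * -form y y}
  have hC : IsClosed C :=
    (isClosed_le continuous_const (continuous_apply 0)).inter
      (isClosed_le ((continuous_apply 0).pow 2) (continuous_const.mul continuous_form_self.neg))
  have hin : ∀ y ∈ polyCone S, y ∈ future → y ∈ C := by
    intro y hy hyf
    obtain ⟨c, hc, hcs⟩ := exists_smul_mem_space hyf
    refine ⟨hyf.2.le, ?_⟩
    have h1 : c * y 0 ≤ M := hM (c • y) (h.mem_iff.2 ⟨hcs, fun n hn => by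
      rw [form_smul_right]; exact mul_nonpos_of_nonneg_of_nonpos hc.le (hy n hn)⟩)
    have h2 := hcs.1
    simp only [form_smul_left, form_smul_right] at h2
    have h3 : c ^ 2 * y 0 ^ 2 ≤ M ^ 2 := by
      have : 0 < c * y 0 := mul_pos hc hyf.2
      nlinarith
    have h4 : c ^ 2 * y 0 ^ 2 ≤ c ^ 2 * (M ^ 2 * -form y y) := by
      have : c ^ 2 * (M ^ 2 * -form y y) = M ^ 2 := by linear_combination (-M ^ 2) * h2
      linarith
    exact le_of_mul_le_mul_left h4 (by positivity)
  have hout : ∀ y ∈ C, y ≠ 0 → y ∈ future := by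
    rintro y ⟨hy1, hy2⟩ hy0
    rcases hy1.eq_or_lt with h0 | h0
    · exfalso
      apply hy0
      have hM2 : 0 ≤ M ^ 2 := sq_nonneg M
      by_cases hM0 : M = 0
      · -- then `X` has no point, since the time coordinate is positive on it
        obtain ⟨z, hz⟩ := h.nonempty
        have := hM z hz
        have := (h.subset_space hz).2
        linarith
      · have : 0 < M ^ 2 := by positivity
        have h3 : 0 ≤ -form y y := by
          rw [← h0] at hy2
          by_contra hneg
          push Not at hneg
          nlinarith
        simp only [form, ← h0] at h3
        ext i
        fin_cases i
        · exact h0.symm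
        · simp; nlinarith [sq_nonneg (y 1), sq_nonneg (y 2), sq_nonneg (y 3)]
        · simp; nlinarith [sq_nonneg (y 1), sq_nonneg (y 2), sq_nonneg (y 3)]
        · simp; nlinarith [sq_nonneg (y 1), sq_nonneg (y 2), sq_nonneg (y 3)]
    · refine ⟨?_, h0⟩
      by_contra hneg
      push Not at hneg
      nlinarith [sq_nonneg M, mul_nonneg (sq_nonneg M) hneg]
  -- a base point such that the segment to `x` avoids the origin
  obtain ⟨p, hp, hpx⟩ : ∃ p ∈ X, ∀ c : ℝ, x ≠ c • p := by
    by_contra hcon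
    push Not at hcon
    have hle : (⊤ : Submodule ℝ Vec) ≤ Submodule.span ℝ {x} := by
      rw [← h.poly.nondegenerate, Submodule.span_le]
      intro p hp
      obtain ⟨c, hc⟩ := hcon p hp
      have hc0 : c ≠ 0 := by rintro rfl; exact hx0 (by simpa using hc)
      exact Submodule.mem_span_singleton.2 ⟨c⁻¹, by
        rw [hc, smul_smul, inv_mul_cancel₀ hc0, one_smul]⟩
    have h1 := Submodule.finrank_mono hle
    have h2 : Module.finrank ℝ Vec = 4 := by simp
    have h3 := finrank_span_singleton (K := ℝ) hx0
    rw [finrank_top] at h1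
    omega
  have hpS := (h.mem_iff.1 hp)
  have hseg : ∀ y ∈ segment ℝ p x, y ∈ polyCone S ∧ y ≠ 0 := by
    rintro y ⟨a, b, ha, hb, hab, rfl⟩
    refine ⟨fun n hn => ?_, fun h0 => ?_⟩
    · simp only [form_add_right, form_smul_right]
      have := mul_nonpos_of_nonneg_of_nonpos ha (hpS.2 n hn)
      have := mul_nonpos_of_nonneg_of_nonpos hb (hx n hn)
      linarith
    · by_cases hb0 : b = 0
      · subst hb0
        have : a = 1 := by linarith
        subst this
        simp only [one_smul, zero_smul, add_zero] at h0
        exact ne_zero_of_future (space_subset_future hpS.1) h0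
      · refine hpx (-(b⁻¹ * a)) ?_
        have : x = b⁻¹ • (b • x) := by rw [smul_smul, inv_mul_cancel₀ hb0, one_smul]
        rw [this, eq_neg_of_add_eq_zero_right h0]
        module
  have hpre : IsPreconnected (segment ℝ p x) := (convex_segment p x).isPreconnected
  rw [isPreconnected_iff_subset_of_disjoint] at hpre
  rcases hpre future Cᶜ isOpen_future hC.isOpen_compl
    (fun y hy => by
      by_cases hyC : y ∈ C
      · exact Or.inl (hout y hyC (hseg y hy).2)
      · exact Or.inr hyC)
    (by
      rw [Set.eq_empty_iff_forall_notMem]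
      rintro y ⟨hy, hyf, hyC⟩
      exact hyC (hin y (hseg y hy).1 hyf)) with h1 | h1
  · exact h1 (right_mem_segment ℝ p x)
  · exact absurd (hin p hpS.2 (space_subset_future hpS.1)) (h1 (left_mem_segment ℝ p x))

theorem exists_smul_mem (h : IsPresentation X S) {x : Vec} (hx : x ∈ polyCone S) (hx0 : x ≠ 0) :
    ∃ c : ℝ, 0 < c ∧ c • x ∈ X := by
  obtain ⟨c, hc, hcs⟩ := exists_smul_mem_space (h.mem_future hx hx0)
  exact ⟨c, hc, h.mem_iff.2 ⟨hcs, fun n hn => by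
    rw [form_smul_right]; exact mul_nonpos_of_nonneg_of_nonpos hc.le (hx n hn)⟩⟩

/-- Tangent vectors of hyperbolic space are not in the cone of a polyhedron. -/
theorem not_mem_polyCone (h : IsPresentation X S) {y z : Vec} (hy : y ∈ space)
    (hz : form y z = 0) (hz0 : z ≠ 0) : z ∉ polyCone S := by
  intro hzS
  have h1 := (h.mem_future hzS hz0).1
  have h2 := form_self_nonneg_of_orth hy hz
  linarith

/-! ### Faces of a presented polyhedron -/

/-- The set on which some of the inequalities are tight is an exposed face, since it is supported by
the sum of their normals. -/
theorem exists_outwardNormal (h : IsPresentation X S) {A : Finset Vec} (hA : A ⊆ S)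
    (hne : A.Nonempty) {y : Vec} (hy : y ∈ faceSet X A) :
    ∃ m, IsOutwardNormal X (faceSet X A) m := by
  have hys := h.subset_space hy.1
  let m := ∑ n ∈ A, n
  have hym : form y m = 0 := by
    rw [form_sum_right]
    exact Finset.sum_eq_zero fun n hn => by rw [form_comm]; exact hy.2 n hn
  have hm0 : m ≠ 0 := by
    obtain ⟨p, hp, hlt⟩ := h.exists_interior
    intro h0
    have : form m p < 0 := by
      rw [form_sum_left]
      exact Finset.sum_neg (fun n hn => hlt n (hA hn)) hne
    rw [h0, form_zero_left] at this
    exact lt_irrefl _ this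
  have hpos := form_self_pos_of_orth hys hym hm0
  have hs := Real.sqrt_pos.2 hpos
  have hmul := Real.mul_self_sqrt hpos.le
  have hle : ∀ x ∈ X, form m x ≤ 0 := fun x hx => by
    rw [form_sum_left]
    exact Finset.sum_nonpos fun n hn => h.form_nonpos (hA hn) hx
  refine ⟨(Real.sqrt (form m m))⁻¹ • m, ?_, fun x hx => ⟨h.subset_space hx, ?_⟩, ?_⟩
  · simp only [form_smul_left, form_smul_right]
    field_simp
    linarith
  · rw [form_smul_left]
    exact mul_nonpos_of_nonneg_of_nonpos (by positivity) (hle x hx)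
  · ext x
    refine ⟨fun hx => ⟨hx.1, h.subset_space hx.1, ?_⟩, fun hx => ⟨hx.1, fun n hn => ?_⟩⟩
    · have h0 : form m x = 0 := by rw [form_sum_left]; exact Finset.sum_eq_zero hx.2
      rw [form_smul_left, h0, mul_zero]
    · have h1 := hx.2.2
      rw [form_smul_left] at h1
      have h2 : form m x = 0 := by
        rcases mul_eq_zero.1 h1 with h3 | h3
        · exact absurd h3 (by positivity)
        · exact h3
      rw [form_sum_left] at h2
      exact (Finset.sum_eq_zero_iff_of_nonpos fun n hn => h.form_nonpos (hA hn) hx.1).1 h2 n hn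

/-- If all inequalities outside `A` are strict at `x`, one can move a little from `x` in every
direction of the subspace cut out by `A`. -/
theorem exists_move (h : IsPresentation X S) {A : Set Vec} {x z : Vec}
    (hx : x ∈ faceSet X A) (hlt : ∀ n ∈ S, n ∉ A → form n x < 0) (hz : z ∈ orthSet A) :
    ∃ ε : ℝ, 0 < ε ∧ x + ε • z ∈ future ∧ x + ε • z ∈ polyCone S := by
  have hc : Continuous fun ε : ℝ => x + ε • z := by fun_prop
  have h1 : ∀ᶠ ε in nhds (0 : ℝ), x + ε • z ∈ future :=
    hc.continuousAt.eventually_mem (isOpen_future.mem_nhds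
      (by simpa using space_subset_future (h.subset_space hx.1)))
  have h2 : ∀ᶠ ε in nhds (0 : ℝ), ∀ n ∈ S, n ∉ A → form n (x + ε • z) < 0 := by
    rw [Filter.eventually_all_finset]
    intro n hn
    by_cases hnA : n ∈ A
    · exact Filter.Eventually.of_forall fun _ h => absurd hnA h
    · have hc2 : Continuous fun ε : ℝ => form n (x + ε • z) := (continuous_form n).comp hc
      have := hc2.continuousAt.eventually_lt (x₀ := 0) (continuousAt_const (y := (0 : ℝ)))
        (by simpa using hlt n hn hnA)
      exact this.mono fun _ h _ => h
  have h3 : ∀ᶠ ε in nhdsWithin (0 : ℝ) (Set.Ioi 0), 0 < ε := self_mem_nhdsWithin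
  obtain ⟨ε, hε, hf, hS⟩ :=
    (h3.and ((h1.filter_mono nhdsWithin_le_nhds).and (h2.filter_mono nhdsWithin_le_nhds))).exists
  refine ⟨ε, hε, hf, fun n hn => ?_⟩
  by_cases hnA : n ∈ A
  · rw [form_add_right, form_smul_right, hx.2 n hnA, hz n hnA]; simp
  · exact (hS n hn hnA).le

theorem span_faceSet (h : IsPresentation X S) {A : Set Vec} {x : Vec}
    (hx : x ∈ faceSet X A) (hlt : ∀ n ∈ S, n ∉ A → form n x < 0) :
    Submodule.span ℝ (faceSet X A) = orthSet A := by
  apply le_antisymm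
  · rw [Submodule.span_le]
    exact fun y hy => hy.2
  · intro z hz
    obtain ⟨ε, hε, hf, hS⟩ := h.exists_move hx hlt hz
    obtain ⟨c, hc, hcs⟩ := h.exists_smul_mem hS (ne_zero_of_future hf)
    have hmem : c • (x + ε • z) ∈ faceSet X A := by
      refine ⟨hcs, fun n hn => ?_⟩
      rw [form_smul_right, form_add_right, form_smul_right, hx.2 n hn, hz n hn]; simp
    have : z = ε⁻¹ • (c⁻¹ • (c • (x + ε • z)) - x) := by
      rw [smul_smul, inv_mul_cancel₀ hc.ne', one_smul, add_sub_cancel_left, smul_smul,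
        inv_mul_cancel₀ hε.ne', one_smul]
    rw [this]
    exact Submodule.smul_mem _ _ (Submodule.sub_mem _
      (Submodule.smul_mem _ _ (Submodule.subset_span hmem)) (Submodule.subset_span hx))

/-- Every nonempty exposed part of `X` is the face on which the inequalities tight at some of its
points (a relatively interior one) are tight. -/
theorem exists_generic (h : IsPresentation X S) {G : Set Vec} {m : Vec}
    (hG : IsOutwardNormal X G m) (hne : G.Nonempty) :
    ∃ A ⊆ S, G = faceSet X A ∧ Submodule.span ℝ G = orthSet A ∧
      ∃ g ∈ G, ∀ n ∈ S, n ∉ A → form n g < 0 := by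
  classical
  let act : Vec → Finset Vec := fun x => S.filter fun n => form n x = 0
  have hGX : ∀ x, x ∈ G ↔ x ∈ X ∧ form m x = 0 := by
    intro x
    rw [hG.contact]
    exact ⟨fun hx => ⟨hx.1, hx.2.2⟩, fun hx => ⟨hx.1, h.subset_space hx.1, hx.2⟩⟩
  -- a point at which the fewest inequalities are tight
  obtain ⟨g, hg, hmin⟩ := WellFounded.has_min
    (measure fun x => (act x).card).wf G hne
  have hgX := ((hGX g).1 hg).1
  have hgen : ∀ x ∈ G, ∀ n ∈ act g, form n x = 0 := by
    intro x hx n hn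
    have hxX := ((hGX x).1 hx).1
    have hfut : g + x ∈ future := future_add (space_subset_future (h.subset_space hgX))
      (space_subset_future (h.subset_space hxX))
    obtain ⟨c, hc, hcs⟩ := h.exists_smul_mem (x := g + x) (fun n hn => by
      rw [form_add_right]; linarith [h.form_nonpos hn hgX, h.form_nonpos hn hxX])
      (ne_zero_of_future hfut)
    have hyG : c • (g + x) ∈ G := (hGX _).2 ⟨hcs, by
      rw [form_smul_right, form_add_right, ((hGX g).1 hg).2, ((hGX x).1 hx).2]; simp⟩
    have hsub : act (c • (g + x)) ⊆ act g := by
      intro n hn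
      obtain ⟨hn, hn0⟩ := Finset.mem_filter.1 hn
      refine Finset.mem_filter.2 ⟨hn, ?_⟩
      rw [form_smul_right, form_add_right] at hn0
      have := h.form_nonpos hn hgX
      have := h.form_nonpos hn hxX
      have : form n g + form n x = 0 := by
        rcases mul_eq_zero.1 hn0 with h3 | h3
        · exact absurd h3 hc.ne'
        · exact h3
      linarith
    have hle : (act g).card ≤ (act (c • (g + x))).card := not_lt.1 (hmin _ hyG)
    rw [← Finset.eq_of_subset_of_card_le hsub hle] at hn
    obtain ⟨hn, hn0⟩ := Finset.mem_filter.1 hn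
    rw [form_smul_right, form_add_right] at hn0
    have := h.form_nonpos hn hgX
    have := h.form_nonpos hn hxX
    have : form n g + form n x = 0 := by
      rcases mul_eq_zero.1 hn0 with h3 | h3
      · exact absurd h3 hc.ne'
      · exact h3
    linarith
  have hgA : g ∈ faceSet X (act g) := ⟨hgX, hgen g hg⟩
  have hlt : ∀ n ∈ S, n ∉ (act g : Set Vec) → form n g < 0 := fun n hn hnA =>
    lt_of_le_of_ne (h.form_nonpos hn hgX) fun h0 => hnA (Finset.mem_coe.2
      (Finset.mem_filter.2 ⟨hn, h0⟩))
  -- the supporting form vanishes along the subspace, as one can move in both directions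
  have hm : ∀ z ∈ orthSet (act g), form m z = 0 := by
    have hm1 : ∀ z ∈ orthSet (act g), form m z ≤ 0 := by
      intro z hz
      obtain ⟨ε, hε, hf, hS⟩ := h.exists_move hgA hlt hz
      obtain ⟨c, hc, hcs⟩ := h.exists_smul_mem hS (ne_zero_of_future hf)
      have h1 := (hG.supports hcs).2
      rw [form_smul_right, form_add_right, form_smul_right, ((hGX g).1 hg).2, zero_add] at h1
      by_contra hpos
      push Not at hpos
      have : 0 < c * (ε * form m z) := by positivity
      linarith
    intro z hz
    have h1 := hm1 z hz
    have h2 := hm1 (-z) (Submodule.neg_mem _ hz)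
    rw [form_neg_right] at h2
    linarith
  have hGeq : G = faceSet X (act g) := by
    ext x
    refine ⟨fun hx => ⟨((hGX x).1 hx).1, hgen x hx⟩, fun hx => (hGX x).2 ⟨hx.1, hm x hx.2⟩⟩
  refine ⟨act g, Finset.filter_subset _ _, hGeq, ?_, g, hg, hlt⟩
  rw [hGeq]
  exact h.span_faceSet hgA hlt

/-- Each facet inequality is tight alone at some point of `X`. -/
theorem exists_facet_point (h : IsPresentation X S) {n : Vec} (hn : n ∈ S) :
    ∃ x ∈ X, form n x = 0 ∧ ∀ m ∈ S, m ≠ n → form m x < 0 := by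
  obtain ⟨p, hp, hlt⟩ := h.exists_interior
  obtain ⟨x, hx, hpos, hle⟩ := h.irredundant n hn
  have hnp := hlt n hn
  have hneg : 0 < -form n p := by linarith
  have hfut : form n x • p + (-form n p) • x ∈ future :=
    future_add (future_smul (space_subset_future (h.subset_space hp)) hpos)
      (future_smul (space_subset_future hx) hneg)
  have h0 : form n (form n x • p + (-form n p) • x) = 0 := by
    simp only [form_add_right, form_smul_right]; ring
  have hm : ∀ m ∈ S, m ≠ n → form m (form n x • p + (-form n p) • x) < 0 := by
    intro m hm hmn
    simp only [form_add_right, form_smul_right]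
    have h1 := mul_neg_of_pos_of_neg hpos (hlt m hm)
    have h2 := mul_nonpos_of_nonneg_of_nonpos hneg.le (hle m hm hmn)
    linarith
  obtain ⟨c, hc, hcs⟩ := h.exists_smul_mem (fun m hm' => by
    by_cases hmn : m = n
    · rw [hmn, h0]
    · exact (hm m hm' hmn).le) (ne_zero_of_future hfut)
  refine ⟨_, hcs, by rw [form_smul_right, h0, mul_zero], fun m hm' hmn => ?_⟩
  rw [form_smul_right]
  exact mul_neg_of_pos_of_neg hc (hm m hm' hmn)

theorem isOutwardNormal (h : IsPresentation X S) {n : Vec} (hn : n ∈ S) :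
    IsOutwardNormal X (faceSet X {n}) n where
  unit := h.unit n hn
  supports := fun _ hx => ⟨h.subset_space hx, h.form_nonpos hn hx⟩
  contact := by
    ext x
    exact ⟨fun hx => ⟨hx.1, h.subset_space hx.1, hx.2 n rfl⟩,
      fun hx => ⟨hx.1, fun m hm => by rw [Set.mem_singleton_iff.1 hm]; exact hx.2.2⟩⟩

theorem span_facet (h : IsPresentation X S) {n : Vec} (hn : n ∈ S) :
    Submodule.span ℝ (faceSet X {n}) = orth n := by
  obtain ⟨x, hx, h0, hlt⟩ := h.exists_facet_point hn
  rw [← orthSet_singleton]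
  exact h.span_faceSet (x := x) ⟨hx, by simpa using h0⟩ fun m hm hmn => hlt m hm hmn

theorem isFace_facet (h : IsPresentation X S) {n : Vec} (hn : n ∈ S) :
    IsFace X (faceSet X {n}) :=
  ⟨⟨n, h.isOutwardNormal hn⟩, by rw [h.span_facet hn, finrank_orth (h.ne_zero hn)]⟩

theorem outwardNormal_facet (h : IsPresentation X S) {n : Vec} (hn : n ∈ S) :
    outwardNormal X (faceSet X {n}) = n :=
  IsOutwardNormal.unique h.poly (h.isFace_facet hn)
    (outwardNormal_spec ⟨n, h.isOutwardNormal hn⟩) (h.isOutwardNormal hn)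

theorem facet_injOn (h : IsPresentation X S) {m n : Vec} (hm : m ∈ S) (hn : n ∈ S)
    (he : faceSet X {m} = faceSet X {n}) : m = n := by
  rw [← h.outwardNormal_facet hm, he, h.outwardNormal_facet hn]

/-- The two-dimensional faces are the facets of the presentation. -/
theorem exists_facet_of_isFace (h : IsPresentation X S) {G : Set Vec} (hG : IsFace X G) :
    ∃ n ∈ S, G = faceSet X {n} := by
  obtain ⟨⟨m, hm⟩, hdim⟩ := id hG
  obtain ⟨A, hA, hGA, hspan, -⟩ := h.exists_generic hm (nonempty_of_isFaceOfDim hG)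
  have hne : A.Nonempty := by
    by_contra hne
    rw [Finset.not_nonempty_iff_eq_empty] at hne
    have : orthSet (A : Set Vec) = ⊤ := by
      rw [hne, eq_top_iff]; intro x _; simp [mem_orthSet]
    rw [hspan, this, finrank_top] at hdim
    simp at hdim
  obtain ⟨n, hn⟩ := hne
  have hle : orthSet (A : Set Vec) ≤ orth n := fun x hx => hx n hn
  have heq : orthSet (A : Set Vec) = orth n := by
    apply Submodule.eq_of_le_of_finrank_eq hle
    rw [finrank_orth (h.ne_zero (hA hn)), ← hspan, hdim]
  refine ⟨n, hA hn, ?_⟩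
  rw [hGA]
  ext x
  refine ⟨fun hx => ⟨hx.1, by simpa using hx.2 n hn⟩, fun hx => ⟨hx.1, ?_⟩⟩
  have : x ∈ orth n := by simpa using hx.2
  rw [← heq] at this
  exact this

/-! ### Vertices -/

theorem finite_vertices (h : IsPresentation X S) : (vertices X).Finite := by
  classical
  have key : ∀ w ∈ vertices X, ∃ A ⊆ S, {w} = faceSet X (A : Set Vec) := by
    intro w hw
    obtain ⟨m, hm⟩ := hw.1
    obtain ⟨A, hA, h1, -⟩ := h.exists_generic hm ⟨w, rfl⟩
    exact ⟨A, hA, h1⟩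
  have : (fun w : Vec => ({w} : Set Vec)) '' vertices X ⊆
      (fun A : Finset Vec => faceSet X (A : Set Vec)) '' (S.powerset : Set (Finset Vec)) := by
    rintro _ ⟨w, hw, rfl⟩
    obtain ⟨A, hA, hw⟩ := key w hw
    exact ⟨A, by simpa using hA, hw.symm⟩
  exact Set.Finite.of_finite_image ((S.powerset.finite_toSet.image _).subset this)
    (Set.singleton_injective.injOn)

/-- A polyhedron is the hull of its vertices, in the following form: a linear form that is
nonpositive at a point of the cone is nonpositive at a vertex of the smallest face containing
that point. -/
theorem exists_vertex_nonpos (h : IsPresentation X S) (g : Vec →ₗ[ℝ] ℝ) {x : Vec}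
    (hx : x ∈ polyCone S) (hx0 : x ≠ 0) (hg : g x ≤ 0) :
    ∃ w ∈ vertices X, g w ≤ 0 ∧ ∀ n ∈ S, form n x = 0 → form n w = 0 := by
  classical
  induction hk : (S.filter fun n => form n x ≠ 0).card using Nat.strong_induction_on
    generalizing x with
  | _ k ih =>
  have hxf := h.mem_future hx hx0
  obtain ⟨c, hc, hcX⟩ := h.exists_smul_mem hx hx0
  by_cases hcase : ∃ z, z ≠ 0 ∧ form x z = 0 ∧ ∀ n ∈ S, form n x = 0 → form n z = 0
  · obtain ⟨z, hz0, hxz, hact⟩ := hcase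
    have hspace : form (c • x) z = 0 := by rw [form_smul_left, hxz, mul_zero]
    have step : ∀ v : Vec, v ≠ 0 → form x v = 0 → (∀ n ∈ S, form n x = 0 → form n v = 0) →
        ∃ t : ℝ, 0 < t ∧ (g (x + t • v) ≤ 0 →
          ∃ w ∈ vertices X, g w ≤ 0 ∧ ∀ n ∈ S, form n x = 0 → form n w = 0) := by
      intro v hv0 hxv hact
      have hvS := h.not_mem_polyCone (h.subset_space hcX)
        (by rw [form_smul_left, hxv, mul_zero] : form (c • x) v = 0) hv0
      obtain ⟨t, ht, htS, n, hn, hnx, hnt⟩ := exists_exit hx hvS hact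
      refine ⟨t, ht, fun hgt => ?_⟩
      have hpres : ∀ n ∈ S, form n x = 0 → form n (x + t • v) = 0 := fun n hn h0 => by
        rw [form_add_right, form_smul_right, h0, hact n hn h0]; simp
      have hne : x + t • v ≠ 0 := by
        intro h0
        have := congrArg (form x) h0
        rw [form_add_right, form_smul_right, hxv, form_zero_right] at this
        linarith [hxf.1]
      have hcard : (S.filter fun n => form n (x + t • v) ≠ 0).card < k := by
        rw [← hk]
        apply Finset.card_lt_card
        refine ⟨fun m hm => ?_, fun hsub => ?_⟩
        · obtain ⟨hm, hm0⟩ := Finset.mem_filter.1 hm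
          exact Finset.mem_filter.2 ⟨hm, fun h0 => hm0 (hpres m hm h0)⟩
        · exact (Finset.mem_filter.1 (hsub (Finset.mem_filter.2 ⟨hn, hnx⟩))).2 hnt
      obtain ⟨w, hw, hgw, hwact⟩ := ih _ hcard htS hne hgt rfl
      exact ⟨w, hw, hgw, fun n hn h0 => hwact n hn (hpres n hn h0)⟩
    obtain ⟨t₁, ht₁, h1⟩ := step z hz0 hxz hact
    obtain ⟨t₂, ht₂, h2⟩ := step (-z) (neg_ne_zero.2 hz0) (by rw [form_neg_right, hxz, neg_zero])
      (fun n hn h0 => by rw [form_neg_right, hact n hn h0, neg_zero])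
    -- `x` lies between the two exit points
    rcases le_or_gt (g z) 0 with hgz | hgz
    · apply h1
      rw [map_add, map_smul, smul_eq_mul]
      have := mul_nonpos_of_nonneg_of_nonpos ht₁.le hgz
      linarith
    · apply h2
      rw [map_add, map_smul, map_neg, smul_eq_mul]
      have := mul_pos ht₂ hgz
      linarith
  · push Not at hcase
    let A := S.filter fun n => form n x = 0
    have hL : ∀ z ∈ orthSet (A : Set Vec), ∃ a : ℝ, z = a • x := by
      intro z hz
      refine ⟨form x z / form x x, ?_⟩
      by_contra hne
      have h1 := hcase (z - (form x z / form x x) • x) (sub_ne_zero.2 hne)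
        (by rw [form_sub_right, form_smul_right, div_mul_cancel₀ _ hxf.1.ne, sub_self])
      obtain ⟨n, hn, h0, h2⟩ := h1
      apply h2
      rw [form_sub_right, form_smul_right, h0,
        hz n (Finset.mem_coe.2 (Finset.mem_filter.2 ⟨hn, h0⟩))]
      simp
    have hmem : c • x ∈ faceSet X (A : Set Vec) := ⟨hcX, fun n hn => by
      rw [form_smul_right, (Finset.mem_filter.1 hn).2, mul_zero]⟩
    have hA : A.Nonempty := by
      by_contra hne
      rw [Finset.not_nonempty_iff_eq_empty] at hne
      have hle : orth x ≤ Submodule.span ℝ {x} := by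
        intro z _
        obtain ⟨a, ha⟩ := hL z (by rw [hne]; simp [mem_orthSet])
        exact Submodule.mem_span_singleton.2 ⟨a, ha.symm⟩
      have h1 := Submodule.finrank_mono hle
      rw [finrank_orth hx0, finrank_span_singleton hx0] at h1
      omega
    have hset : faceSet X (A : Set Vec) = {c • x} := by
      ext y
      refine ⟨fun hy => ?_, fun hy => by rw [Set.mem_singleton_iff.1 hy]; exact hmem⟩
      obtain ⟨a, rfl⟩ := hL y hy.2
      have hy' : (a / c) • (c • x) ∈ space := by
        rw [smul_smul, div_mul_cancel₀ _ hc.ne']; exact h.subset_space hy.1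
      have := eq_of_smul_mem_space (h.subset_space hcX) hy'
      rw [div_eq_one_iff_eq hc.ne'] at this
      rw [this]; rfl
    refine ⟨c • x, ⟨?_, ?_⟩, ?_, fun n hn h0 => by rw [form_smul_right, h0, mul_zero]⟩
    · rw [← hset]
      exact h.exists_outwardNormal (Finset.filter_subset _ _) hA hmem
    · exact finrank_span_singleton (smul_ne_zero hc.ne' hx0)
    · rw [map_smul, smul_eq_mul]
      exact mul_nonpos_of_nonneg_of_nonpos hc.le hg

theorem exists_vertex_neg (h : IsPresentation X S) (g : Vec →ₗ[ℝ] ℝ) {x : Vec}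
    (hx : x ∈ polyCone S) (hg : g x < 0) :
    ∃ w ∈ vertices X, g w < 0 ∧ ∀ n ∈ S, form n x = 0 → form n w = 0 := by
  have hx0 : x ≠ 0 := by rintro rfl; simp at hg
  have hxf := h.mem_future hx hx0
  -- perturb the linear form by a small multiple of the time coordinate
  obtain ⟨w, hw, hgw, hact⟩ := h.exists_vertex_nonpos
    (g + (-(g x) / x 0) • LinearMap.proj 0) hx hx0 (by
      simp [div_mul_cancel₀ _ hxf.2.ne'])
  refine ⟨w, hw, ?_, hact⟩
  have hw0 := (h.subset_space (vertex_mem hw)).2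
  have h1 : 0 < -(g x) / x 0 := div_pos (by linarith) hxf.2
  simp only [LinearMap.add_apply, LinearMap.smul_apply, LinearMap.proj_apply, smul_eq_mul] at hgw
  have := mul_pos h1 hw0
  linarith

end IsPresentation

/-! ### Counting the faces -/

theorem exists_lt_lt_of_two_lt_card {α : Type*} {t : Finset α} {f : α → ℝ}
    (hf : ∀ x ∈ t, ∀ y ∈ t, f x = f y → x = y) (ht : 2 < t.card) :
    ∃ a ∈ t, ∃ w ∈ t, ∃ b ∈ t, f a < f w ∧ f w < f b := by
  classical
  have hne : t.Nonempty := Finset.card_pos.1 (by omega)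
  obtain ⟨a, ha, hmin⟩ := t.exists_min_image f hne
  obtain ⟨b, hb, hmax⟩ := t.exists_max_image f hne
  obtain ⟨w, hw, hwab⟩ := Finset.exists_mem_notMem_of_card_lt_card
    (s := {a, b}) (t := t) (lt_of_le_of_lt Finset.card_le_two ht)
  simp only [Finset.mem_insert, Finset.mem_singleton, not_or] at hwab
  exact ⟨a, ha, w, hw, b, hb, lt_of_le_of_ne (hmin w hw) fun h => hwab.1 (hf _ hw _ ha h.symm),
    lt_of_le_of_ne (hmax w hw) fun h => hwab.2 (hf _ hw _ hb h)⟩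

namespace IsPresentation

variable {X : Set Vec} {S : Finset Vec}

theorem span_facet_vertices (h : IsPresentation X S) {n : Vec} (hn : n ∈ S) :
    Submodule.span ℝ {w ∈ vertices X | form n w = 0} = orth n := by
  apply le_antisymm
  · rw [Submodule.span_le]
    exact fun w hw => hw.2
  · rw [← h.span_facet hn, Submodule.span_le]
    intro y hy
    by_contra hny
    obtain ⟨g, hgy, hg⟩ := Submodule.exists_le_ker_of_notMem hny
    have hyS : y ∈ polyCone S := (h.mem_iff.1 hy.1).2
    have hyn : form n y = 0 := hy.2 n rfl
    have hker : ∀ w ∈ vertices X, form n w = 0 → g w = 0 := fun w hw h0 =>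
      hg (Submodule.subset_span ⟨hw, h0⟩)
    rcases lt_or_gt_of_ne hgy with hlt | hgt
    · obtain ⟨w, hw, hlt, hact⟩ := h.exists_vertex_neg g hyS hlt
      rw [hker w hw (hact n hn hyn)] at hlt
      exact lt_irrefl _ hlt
    · obtain ⟨w, hw, hlt, hact⟩ := h.exists_vertex_neg (-g) hyS (by simpa using hgt)
      rw [LinearMap.neg_apply, hker w hw (hact n hn hyn), neg_zero] at hlt
      exact lt_irrefl _ hlt

theorem two_lt_card_facet_vertices (h : IsPresentation X S) {n : Vec} (hn : n ∈ S)
    {V : Finset Vec} (hV : (V : Set Vec) = {w ∈ vertices X | form n w = 0}) : 2 < V.card := by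
  have h1 := finrank_span_finset_le_card (R := ℝ) V
  rw [Set.finrank, hV, h.span_facet_vertices hn, finrank_orth (h.ne_zero hn)] at h1
  exact h1

/-- A facet inequality that is tight at `w`, `a` and `b`, where `a` and `b` are strictly separated
by a plane through the vertex `w`, is determined by these three points. -/
theorem facet_eq_of_three_points (h : IsPresentation X S) {w a b n m : Vec} (hw : w ∈ vertices X)
    (ha : a ∈ X) (hb : b ∈ X) (g : Vec →ₗ[ℝ] ℝ) (hgw : g w = 0) (hga : g a < 0) (hgb : 0 < g b)
    (hn : n ∈ S) (hm : m ∈ S) (hnw : form n w = 0) (hna : form n a = 0) (hnb : form n b = 0)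
    (hmw : form m w = 0) (hma : form m a = 0) (hmb : form m b = 0) : n = m := by
  have hLI : LinearIndependent ℝ ![a, b, w] := by
    obtain ⟨⟨l, hl⟩, -⟩ := hw
    have hlw : w ∈ X ∩ plane l := by rw [← hl.contact]; rfl
    have hneg : ∀ x ∈ X, g x ≠ 0 → form l x < 0 := fun x hx hgx =>
      lt_of_le_of_ne (hl.supports hx).2 fun h0 => by
        have : x ∈ ({w} : Set Vec) := by
          rw [hl.contact]; exact ⟨hx, h.subset_space hx, h0⟩
        rw [Set.mem_singleton_iff.1 this] at hgx
        exact hgx hgw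
    have hla := hneg a ha hga.ne
    have hlb := hneg b hb hgb.ne'
    rw [Fintype.linearIndependent_iff]
    intro c hc
    simp only [Fin.sum_univ_three, Matrix.cons_val_zero, Matrix.cons_val_one,
      Matrix.cons_val] at hc
    have e1 := congrArg g hc
    have e2 := congrArg (form l) hc
    simp only [map_add, map_smul, smul_eq_mul, map_zero, hgw, form_add_right, form_smul_right,
      form_zero_right, hlw.2.2, mul_zero, add_zero] at e1 e2
    have e3 : c 0 * (g b * form l a - g a * form l b) = 0 := by
      linear_combination g b * e2 - form l b * e1
    have hpos : g b * form l a - g a * form l b < 0 := by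
      have := mul_neg_of_pos_of_neg hgb hla
      have := mul_pos_of_neg_of_neg hga hlb
      linarith
    have h0 : c 0 = 0 := (mul_eq_zero.1 e3).resolve_right hpos.ne
    have h1 : c 1 = 0 := by
      rw [h0, zero_mul, zero_add] at e1
      exact (mul_eq_zero.1 e1).resolve_right hgb.ne'
    have h2 : c 2 = 0 := by
      rw [h0, h1, zero_smul, zero_smul, zero_add, zero_add] at hc
      exact (smul_eq_zero.1 hc).resolve_right
        (ne_zero_of_future (space_subset_future hlw.2.1))
    intro i
    fin_cases i <;> assumption
  have hspan : ∀ k ∈ S, form k w = 0 → form k a = 0 → form k b = 0 →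
      Submodule.span ℝ (Set.range ![a, b, w]) = orth k := by
    intro k hk hkw hka hkb
    apply Submodule.eq_of_le_of_finrank_eq
    · rw [Submodule.span_le]
      rintro _ ⟨i, rfl⟩
      fin_cases i <;> simpa
    · rw [finrank_span_eq_card hLI, finrank_orth (h.ne_zero hk)]; simp
  have heq : orth n = orth m := by
    rw [← hspan n hn hnw hna hnb, hspan m hm hmw hma hmb]
  apply h.facet_injOn hn hm
  ext x
  have : x ∈ orth n ↔ x ∈ orth m := by rw [heq]
  simp only [mem_orth] at this
  simp [faceSet, this]

/-- A plane through a vertex `w` properly crosses at most two of the faces at `w`. -/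
theorem not_three_facets_cross (h : IsPresentation X S) {w : Vec} (hw : w ∈ vertices X)
    (g : Vec →ₗ[ℝ] ℝ) (hgw : g w = 0) {n a b : Fin 3 → Vec} (hinj : Function.Injective n)
    (hn : ∀ i, n i ∈ S) (hnw : ∀ i, form (n i) w = 0) (ha : ∀ i, a i ∈ X) (hb : ∀ i, b i ∈ X)
    (hna : ∀ i, form (n i) (a i) = 0) (hnb : ∀ i, form (n i) (b i) = 0)
    (hga : ∀ i, g (a i) < 0) (hgb : ∀ i, 0 < g (b i)) : False := by
  -- the point at which the segment from `a i` to `b i` meets the plane, up to a factor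
  let c : Fin 3 → Vec := fun i => g (b i) • a i + (-g (a i)) • b i
  have hgc : ∀ i, g (c i) = 0 := fun i => by
    simp only [c, map_add, map_smul, smul_eq_mul]; ring
  have hnc : ∀ i, form (n i) (c i) = 0 := fun i => by
    simp only [c, form_add_right, form_smul_right, hna, hnb]; ring
  have hneg : ∀ i j, i ≠ j → form (n i) (c j) < 0 := by
    intro i j hij
    have h1 := h.form_nonpos (hn i) (ha j)
    have h2 := h.form_nonpos (hn i) (hb j)
    have h3 := mul_nonpos_of_nonneg_of_nonpos (hgb j).le h1
    have h4 := mul_nonpos_of_nonneg_of_nonpos (neg_pos.2 (hga j)).le h2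
    simp only [c, form_add_right, form_smul_right]
    refine lt_of_le_of_ne (by linarith) fun h0 => hij (hinj ?_)
    have h5 : form (n i) (a j) = 0 :=
      (mul_eq_zero.1 (by linarith : g (b j) * form (n i) (a j) = 0)).resolve_left (hgb j).ne'
    have h6 : form (n i) (b j) = 0 :=
      (mul_eq_zero.1 (by linarith : -g (a j) * form (n i) (b j) = 0)).resolve_left
        (neg_pos.2 (hga j)).ne'
    exact h.facet_eq_of_three_points hw (ha j) (hb j) g hgw (hga j) (hgb j) (hn i) (hn j)
      (hnw i) h5 h6 (hnw j) (hna j) (hnb j)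
  have hw0 : w ≠ 0 := ne_zero_of_future (space_subset_future (h.subset_space (vertex_mem hw)))
  have hdep : ¬ LinearIndependent ℝ ![c 0, c 1, c 2, w] := by
    intro hLI
    have hle : Submodule.span ℝ (Set.range ![c 0, c 1, c 2, w]) ≤ LinearMap.ker g := by
      rw [Submodule.span_le]
      rintro _ ⟨i, rfl⟩
      fin_cases i <;> simp [hgc, hgw]
    have h1 := Submodule.finrank_mono hle
    rw [finrank_span_eq_card hLI] at h1
    have hg0 : g ≠ 0 := by rintro rfl; simpa using hga 0
    have h2 := Module.Dual.finrank_ker_add_one_of_ne_zero (f := g) hg0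
    have h3 : Module.finrank ℝ Vec = 4 := by simp
    simp at h1
    omega
  rw [Fintype.not_linearIndependent_iff] at hdep
  obtain ⟨l, hl, i, hi⟩ := hdep
  simp only [Fin.sum_univ_four, Matrix.cons_val_zero, Matrix.cons_val_one, Matrix.cons_val] at hl
  have e : ∀ i, l 0 * form (n i) (c 0) + l 1 * form (n i) (c 1) + l 2 * form (n i) (c 2) = 0 := by
    intro i
    have := congrArg (form (n i)) hl
    simpa only [form_add_right, form_smul_right, hnw, mul_zero, add_zero, form_zero_right]
      using this
  have e0 := e 0
  have e1 := e 1
  have e2 := e 2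
  rw [hnc] at e0 e1 e2
  have h01 := hneg 0 1 (by decide)
  have h02 := hneg 0 2 (by decide)
  have h10 := hneg 1 0 (by decide)
  have h12 := hneg 1 2 (by decide)
  have h20 := hneg 2 0 (by decide)
  have h21 := hneg 2 1 (by decide)
  -- any two of three coefficients would have opposite signs
  have opp : ∀ {x y p r : ℝ}, p < 0 → r < 0 → x * p + y * r = 0 →
      (0 < x → y < 0) ∧ (x < 0 → 0 < y) ∧ (x = 0 → y = 0) := by
    intro x y p r hp hr hxy
    refine ⟨fun hx => ?_, fun hx => ?_, fun hx => ?_⟩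
    · by_contra hy
      push Not at hy
      nlinarith [mul_neg_of_pos_of_neg hx hp, mul_nonpos_of_nonneg_of_nonpos hy hr.le]
    · by_contra hy
      push Not at hy
      nlinarith [mul_pos_of_neg_of_neg hx hp, mul_nonneg_of_nonpos_of_nonpos hy hr.le]
    · rw [hx, zero_mul, zero_add] at hxy
      exact (mul_eq_zero.1 hxy).resolve_right hr.ne
  obtain ⟨p1, p2, p3⟩ := opp h20 h21
    (by linarith : l 0 * form (n 2) (c 0) + l 1 * form (n 2) (c 1) = 0)
  obtain ⟨q1, q2, q3⟩ := opp h10 h12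
    (by linarith : l 0 * form (n 1) (c 0) + l 2 * form (n 1) (c 2) = 0)
  obtain ⟨r1, r2, r3⟩ := opp h01 h02
    (by linarith : l 1 * form (n 0) (c 1) + l 2 * form (n 0) (c 2) = 0)
  have hl0 : l 0 = 0 := by
    rcases lt_trichotomy (l 0) 0 with h0 | h0 | h0
    · linarith [r1 (p2 h0), q2 h0]
    · exact h0
    · linarith [r2 (p1 h0), q1 h0]
  have hl1 := p3 hl0
  have hl2 := q3 hl0
  have hl3 : l 3 = 0 := by
    rw [hl0, hl1, hl2] at hl
    simp only [zero_smul, zero_add] at hl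
    exact (smul_eq_zero.1 hl).resolve_right hw0
  apply hi
  fin_cases i <;> assumption

/-- A polyhedron with `N` vertices has at most `2N` faces.  With respect to a generic height
function every face has a vertex that is neither its highest nor its lowest one, and each
vertex plays this role for at most two faces. -/
theorem card_le (h : IsPresentation X S) : S.card ≤ 2 * (vertices X).ncard := by
  classical
  let V := h.finite_vertices.toFinset
  have hV : ∀ w, w ∈ V ↔ w ∈ vertices X := fun w => h.finite_vertices.mem_toFinset
  have hVs : ∀ w ∈ V, w ∈ space := fun w hw => h.subset_space (vertex_mem ((hV w).1 hw))
  rw [Set.ncard_eq_toFinset_card _ h.finite_vertices]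
  obtain ⟨g, hg⟩ := Module.exists_dual_forall_apply_ne_zero (K := ℝ)
    (ι := {p : V × V // p.1 ≠ p.2})
    (fun p => (p.1.2 : Vec) 0 • (p.1.1 : Vec) - (p.1.1 : Vec) 0 • (p.1.2 : Vec)) (by
      rintro ⟨⟨⟨w, hw⟩, ⟨w', hw'⟩⟩, hne⟩ h0
      apply hne
      simp only [sub_eq_zero] at h0
      have h1 := (hVs w hw).2
      have h2 : w' = ((w' 0) / (w 0)) • w := by
        rw [div_eq_inv_mul, mul_smul, h0, smul_smul, inv_mul_cancel₀ h1.ne', one_smul]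
      have h3 := eq_of_smul_mem_space (hVs w hw) (h2 ▸ hVs w' hw')
      rw [h3, one_smul] at h2
      exact Subtype.ext h2.symm)
  -- the height of a vertex is `g w / w 0`
  have hinj : ∀ x ∈ V, ∀ y ∈ V, g x / x 0 = g y / y 0 → x = y := by
    intro x hx y hy hxy
    by_contra hne
    apply hg ⟨⟨⟨x, hx⟩, ⟨y, hy⟩⟩, fun h => hne (congrArg Subtype.val h)⟩
    have h1 := (hVs x hx).2
    have h2 := (hVs y hy).2
    rw [div_eq_div_iff h1.ne' h2.ne'] at hxy
    simp only [map_sub, map_smul, smul_eq_mul]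
    linarith
  have hmid : ∀ n, ∃ a w b : Vec, n ∈ S → (a ∈ V ∧ w ∈ V ∧ b ∈ V ∧ form n a = 0 ∧ form n w = 0 ∧
      form n b = 0 ∧ g a / a 0 < g w / w 0 ∧ g w / w 0 < g b / b 0) := by
    intro n
    by_cases hn : n ∈ S
    · obtain ⟨a, ha, w, hw, b, hb, h1, h2⟩ := exists_lt_lt_of_two_lt_card
        (t := V.filter fun w => form n w = 0) (f := fun w => g w / w 0)
        (fun x hx y hy hxy => hinj x (Finset.mem_filter.1 hx).1 y (Finset.mem_filter.1 hy).1 hxy)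
        (h.two_lt_card_facet_vertices hn (by ext w; simp [hV]))
      rw [Finset.mem_filter] at ha hw hb
      exact ⟨a, w, b, fun _ => ⟨ha.1, hw.1, hb.1, ha.2, hw.2, hb.2, h1, h2⟩⟩
    · exact ⟨0, 0, 0, fun h => absurd h hn⟩
  choose a mid b hmid using hmid
  refine Finset.card_le_mul_card_image_of_maps_to (f := mid) (fun n hn => (hmid n hn).2.1) 2
    fun w hw => ?_
  by_contra hcard
  push Not at hcard
  obtain ⟨n₁, n₂, n₃, h1, h2, h3, h12, h13, h23⟩ := Finset.two_lt_card_iff.1 hcard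
  rw [Finset.mem_filter] at h1 h2 h3
  let n : Fin 3 → Vec := ![n₁, n₂, n₃]
  have hn : ∀ i, n i ∈ S ∧ mid (n i) = w := by
    intro i
    fin_cases i
    exacts [h1, h2, h3]
  have hninj : Function.Injective n := by
    intro i j hij
    fin_cases i <;> fin_cases j
    exacts [rfl, (h12 hij).elim, (h13 hij).elim, (h12 hij.symm).elim, rfl, (h23 hij).elim,
      (h13 hij.symm).elim, (h23 hij.symm).elim, rfl]
  have hw0 := (hVs w hw).2
  have key := fun i => hmid (n i) (hn i).1
  refine h.not_three_facets_cross (n := n) (a := fun i => a (n i)) (b := fun i => b (n i))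
    ((hV w).1 hw) (w 0 • g - g w • LinearMap.proj 0) ?_ hninj (fun i => (hn i).1) ?_ ?_ ?_ ?_ ?_
    ?_ ?_
  · simp; ring
  · exact fun i => by have := (key i).2.2.2.2.1; rwa [(hn i).2] at this
  · exact fun i => vertex_mem ((hV _).1 (key i).1)
  · exact fun i => vertex_mem ((hV _).1 (key i).2.2.1)
  · exact fun i => (key i).2.2.2.1
  · exact fun i => (key i).2.2.2.2.2.1
  · intro i
    have h4 := (key i).2.2.2.2.2.2.1
    rw [(hn i).2, div_lt_div_iff₀ (hVs _ (key i).1).2 hw0] at h4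
    simp only [LinearMap.sub_apply, LinearMap.smul_apply, LinearMap.proj_apply, smul_eq_mul]
    linarith
  · intro i
    have h4 := (key i).2.2.2.2.2.2.2
    rw [(hn i).2, div_lt_div_iff₀ hw0 (hVs _ (key i).2.2.1).2] at h4
    simp only [LinearMap.sub_apply, LinearMap.smul_apply, LinearMap.proj_apply, smul_eq_mul]
    linarith

end IsPresentation

/-! ### A plane far from the vertices -/

theorem one_le_neg_form {x y : Vec} (hx : x ∈ space) (hy : y ∈ space) : 1 ≤ -form x y := by
  linarith [form_le_neg_one hx hy]

theorem IsPresentation.exists_hdist_eq_hdiam {X : Set Vec} {S : Finset Vec}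
    (h : IsPresentation X S) : ∃ u ∈ X, ∃ v ∈ X, hdist u v = hdiam X := by
  have hcont : Continuous fun p : Vec × Vec => -form p.1 p.2 := by
    unfold form; fun_prop
  obtain ⟨⟨u, v⟩, ⟨hu, hv⟩, hmax⟩ := (h.poly.compact.prod h.poly.compact).exists_isMaxOn
    (h.nonempty.prod h.nonempty) hcont.continuousOn
  refine ⟨u, hu, v, hv, ?_⟩
  have hgreat : IsGreatest {r | ∃ x ∈ X, ∃ y ∈ X, r = hdist x y} (hdist u v) := by
    refine ⟨⟨u, hu, v, hv, rfl⟩, ?_⟩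
    rintro _ ⟨x, hx, y, hy, rfl⟩
    have h1 := one_le_neg_form (h.subset_space hu) (h.subset_space hv)
    have h2 := one_le_neg_form (h.subset_space hx) (h.subset_space hy)
    exact (Real.arcosh_le_arcosh (by linarith) (by linarith)).2
      (hmax (Set.mk_mem_prod hx hy))
  exact hgreat.csSup_eq.symm

/-- The component of `x` orthogonal to both `p` and `n` is spacelike. -/
theorem le_form_self {p n x : Vec} (hp : p ∈ space) (hn : form n n = 1) (hpn : form p n = 0) :
    form n x ^ 2 - form p x ^ 2 ≤ form x x := by
  obtain ⟨a, b, -, -, -, -, -, -, -, hexp⟩ := exists_frame hp hn hpn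
  rw [hexp x x]
  nlinarith [sq_nonneg (form a x), sq_nonneg (form b x)]

theorem exists_sinh_cosh {x z : ℝ} (hz : 0 < z) (hxz : x ^ 2 < z ^ 2) :
    ∃ K t : ℝ, 0 < K ∧ x = K * Real.sinh t ∧ z = K * Real.cosh t := by
  have hpos : 0 < z ^ 2 - x ^ 2 := by linarith
  have hK := Real.sqrt_pos.2 hpos
  have hKK := Real.sq_sqrt hpos.le
  refine ⟨Real.sqrt (z ^ 2 - x ^ 2), Real.arsinh (x / Real.sqrt (z ^ 2 - x ^ 2)), hK, ?_, ?_⟩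
  · rw [Real.sinh_arsinh]; field_simp
  · rw [Real.cosh_arsinh]
    have : 1 + (x / Real.sqrt (z ^ 2 - x ^ 2)) ^ 2 = (z / Real.sqrt (z ^ 2 - x ^ 2)) ^ 2 := by
      rw [div_pow, div_pow, hKK]; field_simp; ring
    rw [this, Real.sqrt_sq (by positivity)]
    field_simp

theorem tanh_mul_cosh_le_abs_sinh {r a : ℝ} (h : r ≤ |a|) :
    Real.tanh r * Real.cosh a ≤ |Real.sinh a| := by
  have h1 : 0 ≤ Real.sinh (|a| - r) := Real.sinh_nonneg_iff.2 (by linarith)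
  rw [Real.sinh_sub, Real.cosh_abs] at h1
  have hs : Real.sinh |a| = |Real.sinh a| := by
    rcases abs_cases a with ⟨h2, h3⟩ | ⟨h2, h3⟩
    · rw [h2, abs_of_nonneg (Real.sinh_nonneg_iff.2 h3)]
    · rw [h2, Real.sinh_neg, abs_of_neg (Real.sinh_neg_iff.2 h3)]
  rw [hs] at h1
  rw [Real.tanh_eq_sinh_div_cosh, div_mul_eq_mul_div, div_le_iff₀ (Real.cosh_pos r)]
  linarith

/-- Among `N` points of the line, one of which is not positive, there is a gap of length `ρ / N`
inside the interval from `0` to `ρ`; here `t` is its midpoint. -/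
theorem exists_gap {α : Type*} (V : Finset α) (τ : α → ℝ) {ρ : ℝ} (hρ : 0 < ρ)
    {w₀ : α} (hw₀ : w₀ ∈ V) (hτ : τ w₀ ≤ 0) :
    ∃ t, 0 < t ∧ t < ρ ∧ ∀ w ∈ V, ρ / (2 * V.card) ≤ |τ w - t| := by
  classical
  have hpos : 0 < V.card := Finset.card_pos.2 ⟨w₀, hw₀⟩
  have hN : (0 : ℝ) < V.card := by exact_mod_cast hpos
  obtain ⟨j, hj, hjn⟩ := Finset.exists_mem_notMem_of_card_lt_card
    (s := (V.erase w₀).image fun w => ⌊τ w * V.card / ρ⌋)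
    (t := (Finset.range V.card).image fun i : ℕ => (i : ℤ)) (by
      rw [Finset.card_image_of_injective _ Nat.cast_injective, Finset.card_range]
      refine lt_of_le_of_lt Finset.card_image_le ?_
      rw [Finset.card_erase_of_mem hw₀]
      omega)
  obtain ⟨i, hi, rfl⟩ := Finset.mem_image.1 hj
  rw [Finset.mem_range] at hi
  have hi1 : ((i : ℝ) + 1) ≤ V.card := by exact_mod_cast hi
  have hi0 : (0 : ℝ) ≤ i := Nat.cast_nonneg i
  refine ⟨(i + 1 / 2) * (ρ / V.card), by positivity, ?_, fun w hw => ?_⟩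
  · rw [← mul_div_assoc, div_lt_iff₀ hN]
    nlinarith
  · have hsplit : ρ / (2 * V.card) = 1 / 2 * (ρ / V.card) := by field_simp
    have hδ : 0 < ρ / V.card := by positivity
    rw [hsplit]
    by_cases hww : w = w₀
    · subst hww
      rw [le_abs]
      right
      nlinarith [mul_nonneg hi0 hδ.le]
    · have hne : ⌊τ w * V.card / ρ⌋ ≠ (i : ℤ) := fun h0 =>
        hjn (Finset.mem_image.2 ⟨w, Finset.mem_erase.2 ⟨hww, hw⟩, h0⟩)
      have hτw : τ w = τ w * V.card / ρ * (ρ / V.card) := by field_simp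
      rw [hτw, ← sub_mul, abs_mul, abs_of_pos hδ]
      refine mul_le_mul_of_nonneg_right ?_ hδ.le
      rcases lt_or_gt_of_ne hne with hlt | hgt
      · rw [Int.floor_lt] at hlt
        push_cast at hlt
        rw [le_abs]; right; linarith
      · have hgt' : ((i : ℤ) + 1) ≤ ⌊τ w * V.card / ρ⌋ := hgt
        rw [Int.le_floor] at hgt'
        push_cast at hgt'
        rw [le_abs]; left; linarith

/-- The plane with unit normal `n`, with the point `o` of this plane as centre, is such that all
vertices of `X` lie in the two half-spaces cut off by the planes which are orthogonal to the
geodesic through `o` in the direction `n` and have the distance `artanh T` from `o`. -/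
structure IsFarPlane (X : Set Vec) (n o : Vec) (T : ℝ) : Prop where
  unit : form n n = 1
  center : o ∈ space
  orth : form o n = 0
  pos : 0 < T
  lt_one : T < 1
  far : ∀ w ∈ vertices X, T * -form o w ≤ |form n w|

theorem IsPresentation.exists_isFarPlane {X : Set Vec} {S : Finset Vec} (h : IsPresentation X S)
    {u v : Vec} {ρ : ℝ} (hu : u ∈ X) (hv : v ∈ X) (huv : hdist u v = ρ) (hρ : 0 < ρ) :
    ∃ n o, IsFarPlane X n o (Real.tanh (ρ / (2 * (vertices X).ncard))) ∧
      n ∈ Submodule.span ℝ {u, v} ∧ form n u < 0 ∧ 0 < form n v ∧ 0 < (vertices X).ncard := by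
  classical
  have hus := h.subset_space hu
  have hvs := h.subset_space hv
  have hC : form u v = -Real.cosh ρ := by
    rw [← huv, hdist, Real.cosh_arcosh (one_le_neg_form hus hvs)]; ring
  have hS : 0 < Real.sinh ρ := Real.sinh_pos_iff.2 hρ
  have hCS := Real.cosh_sq ρ
  let n₀ : Vec := (Real.sinh ρ)⁻¹ • (v - Real.cosh ρ • u)
  have hv_eq : v = Real.cosh ρ • u + Real.sinh ρ • n₀ := by
    simp only [n₀, smul_smul, mul_inv_cancel₀ hS.ne', one_smul]; abel
  have hun : form u n₀ = 0 := by
    simp only [n₀, form_smul_right, form_sub_right, hC, hus.1]; ring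
  have hnn : form n₀ n₀ = 1 := by
    have hvu : form v u = -Real.cosh ρ := by rw [form_comm, hC]
    simp only [n₀, form_smul_right, form_smul_left, form_sub_left, form_sub_right, hC, hus.1,
      hvs.1, hvu]
    field_simp
    linarith
  let V := h.finite_vertices.toFinset
  have hV : ∀ w, w ∈ V ↔ w ∈ vertices X := fun w => h.finite_vertices.mem_toFinset
  have hVs : ∀ w ∈ V, w ∈ space := fun w hw => h.subset_space (vertex_mem ((hV w).1 hw))
  rw [Set.ncard_eq_toFinset_card _ h.finite_vertices]
  -- the position `τ w` of the projection of a vertex to the line through `u` and `v`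
  have hpar : ∀ w, ∃ K t : ℝ, w ∈ V → 0 < K ∧ form n₀ w = K * Real.sinh t ∧
      -form u w = K * Real.cosh t := by
    intro w
    by_cases hw : w ∈ V
    · have h1 := one_le_neg_form hus (hVs w hw)
      have h2 := le_form_self (x := w) hus hnn hun
      rw [(hVs w hw).1] at h2
      obtain ⟨K, t, hKt⟩ := exists_sinh_cosh (x := form n₀ w) (z := -form u w) (by linarith)
        (by nlinarith)
      exact ⟨K, t, fun _ => hKt⟩
    · exact ⟨0, 0, fun h => absurd h hw⟩
  choose K τ hKτ using hpar
  obtain ⟨w₀, hw₀, hneg, -⟩ := h.exists_vertex_nonpos (bilin n₀) (h.mem_iff.1 hu).2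
    (ne_zero_of_future (space_subset_future hus))
    (by rw [bilin_apply, form_comm, hun])
  have hτ₀ : τ w₀ ≤ 0 := by
    obtain ⟨h1, h2, -⟩ := hKτ w₀ ((hV w₀).2 hw₀)
    rw [bilin_apply, h2] at hneg
    by_contra hcon
    push Not at hcon
    have := mul_pos h1 (Real.sinh_pos_iff.2 hcon)
    linarith
  obtain ⟨t, ht0, htρ, hgap⟩ := exists_gap V τ hρ ((hV w₀).2 hw₀) hτ₀
  have hst : 0 < Real.sinh t := Real.sinh_pos_iff.2 ht0
  have hcst := Real.cosh_sq t
  let o : Vec := Real.cosh t • u + Real.sinh t • n₀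
  let n : Vec := Real.sinh t • u + Real.cosh t • n₀
  have hnu : form n₀ u = 0 := by rw [form_comm, hun]
  have hnform : ∀ w, form n w = Real.sinh t * form u w + Real.cosh t * form n₀ w := fun w => by
    simp only [n, form_add_left, form_smul_left]
  have hoform : ∀ w, form o w = Real.cosh t * form u w + Real.sinh t * form n₀ w := fun w => by
    simp only [o, form_add_left, form_smul_left]
  have hpos : 0 < V.card := Finset.card_pos.2 ⟨w₀, (hV w₀).2 hw₀⟩
  have hN : (0 : ℝ) < V.card := by exact_mod_cast hpos
  refine ⟨n, o, ⟨?_, ⟨?_, ?_⟩, ?_, ?_, Real.tanh_lt_one _, ?_⟩, ?_, ?_, ?_, hpos⟩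
  · rw [hnform]
    simp only [n, form_add_right, form_smul_right, hun, hnu, hus.1, hnn]
    linarith
  · rw [hoform]
    simp only [o, form_add_right, form_smul_right, hun, hnu, hus.1, hnn]
    linarith
  · -- `o` is a positive combination of `u` and `v`
    have hoeq : o = (Real.sinh (ρ - t) / Real.sinh ρ) • u + (Real.sinh t / Real.sinh ρ) • v := by
      have e1 : Real.cosh t = Real.sinh (ρ - t) / Real.sinh ρ +
          Real.sinh t / Real.sinh ρ * Real.cosh ρ := by
        rw [Real.sinh_sub]; field_simp; ring
      have e2 : Real.sinh t = Real.sinh t / Real.sinh ρ * Real.sinh ρ := by field_simp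
      calc o = (Real.sinh (ρ - t) / Real.sinh ρ + Real.sinh t / Real.sinh ρ * Real.cosh ρ) • u +
            (Real.sinh t / Real.sinh ρ * Real.sinh ρ) • n₀ := by rw [← e1, ← e2]
        _ = (Real.sinh (ρ - t) / Real.sinh ρ) • u + (Real.sinh t / Real.sinh ρ) •
            (Real.cosh ρ • u + Real.sinh ρ • n₀) := by module
        _ = _ := by rw [← hv_eq]
    rw [hoeq]
    have h1 : 0 < Real.sinh (ρ - t) := Real.sinh_pos_iff.2 (by linarith)
    exact (future_add (future_smul (space_subset_future hus) (div_pos h1 hS))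
      (future_smul (space_subset_future hvs) (div_pos hst hS))).2
  · rw [hoform]
    simp only [n, form_add_right, form_smul_right, hun, hnu, hus.1, hnn]
    ring
  · rw [Real.tanh_eq_sinh_div_cosh]
    exact div_pos (Real.sinh_pos_iff.2 (div_pos hρ (mul_pos two_pos hN))) (Real.cosh_pos _)
  · intro w hw
    obtain ⟨h1, h2, h3⟩ := hKτ w ((hV w).2 hw)
    have e1 : form n w = K w * Real.sinh (τ w - t) := by
      rw [hnform, h2, (by linarith : form u w = -(K w * Real.cosh (τ w))), Real.sinh_sub]; ring
    have e2 : -form o w = K w * Real.cosh (τ w - t) := by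
      rw [hoform, h2, (by linarith : form u w = -(K w * Real.cosh (τ w))), Real.cosh_sub]; ring
    rw [e1, e2, abs_mul, abs_of_pos h1, mul_left_comm]
    exact mul_le_mul_of_nonneg_left
      (tanh_mul_cosh_le_abs_sinh (hgap w ((hV w).2 hw))) h1.le
  · have hu' : u ∈ Submodule.span ℝ {u, v} := Submodule.subset_span (Set.mem_insert u {v})
    have hv' : v ∈ Submodule.span ℝ {u, v} := Submodule.subset_span (Set.mem_insert_of_mem u rfl)
    exact Submodule.add_mem _ (Submodule.smul_mem _ _ hu') (Submodule.smul_mem _ _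
      (Submodule.smul_mem _ _ (Submodule.sub_mem _ hv' (Submodule.smul_mem _ _ hu'))))
  · rw [hnform, hus.1, hnu]; linarith
  · have hn0v : form n₀ v = Real.sinh ρ := by
      rw [hv_eq, form_add_right, form_smul_right, form_smul_right, hnu, hnn]; ring
    rw [hnform, hC, hn0v]
    have := Real.sinh_pos_iff.2 (by linarith : 0 < ρ - t)
    rw [Real.sinh_sub] at this
    linarith

/-! ### Estimates for a far plane -/

namespace IsFarPlane

variable {X : Set Vec} {S : Finset Vec} {n o : Vec} {T : ℝ}

theorem form_ne_zero (hP : IsFarPlane X n o T) (h : IsPresentation X S) {w : Vec}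
    (hw : w ∈ vertices X) : form n w ≠ 0 := by
  intro h0
  have h1 := hP.far w hw
  have h2 := mul_pos hP.pos
    (by linarith [one_le_neg_form hP.center (h.subset_space (vertex_mem hw))] : 0 < -form o w)
  rw [h0, abs_zero] at h1
  linarith

theorem le_hdist {r : ℝ} (hP : IsFarPlane X n o (Real.tanh r)) (h : IsPresentation X S)
    (hr : 0 < r) {w y : Vec} (hw : w ∈ vertices X) (hy : y ∈ plane n) : r ≤ hdist w y := by
  have hws := h.subset_space (vertex_mem hw)
  have h1 := one_le_neg_form hP.center hws
  have h2 := le_form_self (x := w) hP.center hP.unit hP.orth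
  rw [hws.1] at h2
  have h3 := hP.far w hw
  have hT := hP.pos
  have h4 : Real.tanh r ^ 2 * form o w ^ 2 ≤ form n w ^ 2 := by
    have : (Real.tanh r * -form o w) ^ 2 ≤ |form n w| ^ 2 :=
      pow_le_pow_left₀ (mul_nonneg hT.le (by linarith)) h3 2
    rw [sq_abs] at this
    linarith
  have h5 := le_form_self (p := y) (x := w) hy.1 hP.unit (by rw [form_comm]; exact hy.2)
  rw [hws.1] at h5
  have hc := Real.cosh_pos r
  have hcs := Real.cosh_sq r
  have h6 : Real.cosh r ^ 2 ≤ form y w ^ 2 := by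
    have e1 : Real.tanh r * Real.cosh r = Real.sinh r := by
      rw [Real.tanh_eq_sinh_div_cosh, div_mul_cancel₀ _ hc.ne']
    have e2 : Real.sinh r ^ 2 * form o w ^ 2 ≤ Real.cosh r ^ 2 * form n w ^ 2 := by
      rw [← e1]
      nlinarith [mul_le_mul_of_nonneg_left h4 (sq_nonneg (Real.cosh r))]
    nlinarith [mul_le_mul_of_nonneg_left (by linarith : 1 + form n w ^ 2 ≤ form o w ^ 2)
      (sq_nonneg (Real.sinh r))]
  have h7 := one_le_neg_form hy.1 hws
  have h8 : Real.cosh r ≤ -form y w := by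
    apply le_of_sq_le_sq _ (by linarith)
    linarith
  rw [hdist, form_comm, ← Real.arcosh_cosh hr.le]
  exact (Real.arcosh_le_arcosh hc (by linarith)).2 h8

/-- A plane that contains vertices on both sides of a far plane is almost orthogonal to it. -/
theorem form_sq_le (hP : IsFarPlane X n o T) {l w₁ w₂ : Vec} (hl : form l l = 1)
    (hw₁ : w₁ ∈ space) (hw₂ : w₂ ∈ space) (h₁ : form l w₁ = 0) (h₂ : form l w₂ = 0)
    (hpos : T * -form o w₁ ≤ form n w₁) (hneg : T * -form o w₂ ≤ -form n w₂) :
    form l n ^ 2 ≤ 1 - T ^ 2 := by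
  -- Cauchy–Schwarz in the tangent space at `w`, for the projection of `n`
  have key : ∀ w ∈ space, form l w = 0 → ∀ ξ, form n w = ξ * -form o w →
      (form l n + ξ * form l o) ^ 2 ≤ 1 - ξ ^ 2 := by
    intro w hw hlw ξ hξ
    have h1 : form w (n + ξ • o) = 0 := by
      rw [form_add_right, form_smul_right, form_comm w n, form_comm w o, hξ]; ring
    have h2 := form_sq_le_of_orth hw (by rw [form_comm]; exact hlw) h1
    have hno : form n o = 0 := by rw [form_comm]; exact hP.orth
    simp only [form_add_left, form_add_right, form_smul_left, form_smul_right, hl, hP.unit,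
      hP.orth, hno, hP.center.1] at h2
    linarith
  have z1 : 0 < -form o w₁ := by linarith [one_le_neg_form hP.center hw₁]
  have z2 : 0 < -form o w₂ := by linarith [one_le_neg_form hP.center hw₂]
  have k1 := key w₁ hw₁ h₁ (form n w₁ / -form o w₁) (div_mul_cancel₀ _ z1.ne').symm
  have k2 := key w₂ hw₂ h₂ (form n w₂ / -form o w₂) (div_mul_cancel₀ _ z2.ne').symm
  have x1 : T ≤ form n w₁ / -form o w₁ := by rwa [le_div_iff₀ z1]
  have x2 : T ≤ -(form n w₂ / -form o w₂) := by
    rw [← neg_div, le_div_iff₀ z2]; exact hneg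
  set ξ₁ := form n w₁ / -form o w₁
  set ξ₂ := form n w₂ / -form o w₂
  have hT := hP.pos
  have s1 : T ^ 2 ≤ ξ₁ ^ 2 := by nlinarith
  have s2 : T ^ 2 ≤ ξ₂ ^ 2 := by nlinarith
  -- the bounded quantity lies between the two quantities just estimated
  rcases le_total 0 (form l n * form l o) with hd | hd
  · have : 0 ≤ ξ₁ * (form l n * form l o) := mul_nonneg (by linarith) hd
    nlinarith [sq_nonneg (ξ₁ * form l o)]
  · have : 0 ≤ -ξ₂ * -(form l n * form l o) := mul_nonneg (by linarith) (by linarith)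
    nlinarith [sq_nonneg (ξ₂ * form l o)]

/-- The section of the polyhedron by a far plane is contained in a small disk around `o`. -/
theorem sq_mul_form_sq_le (hP : IsFarPlane X n o T) (h : IsPresentation X S) {y : Vec}
    (hy : y ∈ X) (hyn : form n y = 0) : T ^ 2 * form o y ^ 2 ≤ 1 := by
  obtain ⟨a, b, -, -, -, -, -, -, -, hexp⟩ := exists_frame hP.center hP.unit hP.orth
  have hys := h.subset_space hy
  have hT := hP.pos
  have hT1 := hP.lt_one
  have hz := one_le_neg_form hP.center hys
  have e := hexp y y
  rw [hys.1, hyn] at e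
  by_contra hcon
  push Not at hcon
  set A := form a y
  set B := form b y
  set z := form o y
  have hk : 0 < 1 - T ^ 2 := by nlinarith
  have hks := Real.sq_sqrt hk.le
  set k := Real.sqrt (1 - T ^ 2)
  have hk0 : 0 ≤ k := Real.sqrt_nonneg _
  have hR2 : k ^ 2 * z ^ 2 < A ^ 2 + B ^ 2 := by rw [hks]; nlinarith
  have hRs := Real.sq_sqrt (by positivity : 0 ≤ A ^ 2 + B ^ 2)
  set R := Real.sqrt (A ^ 2 + B ^ 2)
  have hR0 : 0 ≤ R := Real.sqrt_nonneg _
  have hkz : k * -z < R := by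
    apply lt_of_pow_lt_pow_left₀ 2 hR0
    nlinarith
  have hRpos : 0 < R := lt_of_le_of_lt (mul_nonneg hk0 (by linarith)) hkz
  -- all vertices lie on one side of a hyperplane that has `y` on the other side
  obtain ⟨w, hw, hgw, -⟩ := h.exists_vertex_neg (-(k * R) • bilin o - A • bilin a - B • bilin b)
    (h.mem_iff.1 hy).2 (by
      simp only [LinearMap.sub_apply, LinearMap.smul_apply, bilin_apply, smul_eq_mul]
      change -(k * R) * z - A * A - B * B < 0
      nlinarith [mul_lt_mul_of_pos_left hkz hRpos])
  have hws := h.subset_space (vertex_mem hw)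
  have hzw := one_le_neg_form hP.center hws
  have ew := hexp w w
  rw [hws.1] at ew
  have hfar := hP.far w hw
  have hfar2 : T ^ 2 * form o w ^ 2 ≤ form n w ^ 2 := by
    have : (T * -form o w) ^ 2 ≤ |form n w| ^ 2 :=
      pow_le_pow_left₀ (mul_nonneg hT.le (by linarith)) hfar 2
    rw [sq_abs] at this
    linarith
  simp only [LinearMap.sub_apply, LinearMap.smul_apply, bilin_apply, smul_eq_mul] at hgw
  have hCS : A * form a w + B * form b w ≤ R * (k * -form o w) := by
    apply le_of_sq_le_sq _ (mul_nonneg hR0 (mul_nonneg hk0 (by linarith)))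
    calc (A * form a w + B * form b w) ^ 2
        ≤ (A ^ 2 + B ^ 2) * (form a w ^ 2 + form b w ^ 2) := by
          nlinarith [sq_nonneg (A * form b w - B * form a w)]
      _ ≤ R ^ 2 * ((1 - T ^ 2) * form o w ^ 2) := by
          rw [hRs]
          exact mul_le_mul_of_nonneg_left (by nlinarith) (by positivity)
      _ = (R * (k * -form o w)) ^ 2 := by rw [← hks]; ring
  linarith

/-- A bound for the diameter of the section by a far plane. -/
theorem sq_mul_neg_form_le (hP : IsFarPlane X n o T) (h : IsPresentation X S) {p y : Vec}
    (hp : p ∈ X) (hpn : form n p = 0) (hy : y ∈ X) (hyn : form n y = 0) :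
    T ^ 2 * -form p y ≤ 2 - T ^ 2 := by
  obtain ⟨a, b, -, -, -, -, -, -, -, hexp⟩ := exists_frame hP.center hP.unit hP.orth
  have hps := h.subset_space hp
  have hys := h.subset_space hy
  have e1 := hexp p p
  have e2 := hexp y y
  have e3 := hexp p y
  rw [hps.1, hpn] at e1
  rw [hys.1, hyn] at e2
  rw [hpn, hyn] at e3
  have b1 := hP.sq_mul_form_sq_le h hp hpn
  have b2 := hP.sq_mul_form_sq_le h hy hyn
  have hT := hP.pos
  have hT1 := hP.lt_one
  have hT2 : T ^ 2 ≤ 1 := by nlinarith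
  have i1 : T ^ 2 * (form o p * form o y) ≤ 1 := by
    nlinarith [mul_nonneg (sq_nonneg T) (sq_nonneg (form o p - form o y))]
  have i2 : T ^ 2 * -(form a p * form a y + form b p * form b y) ≤ 1 - T ^ 2 := by
    nlinarith [mul_nonneg (sq_nonneg T) (sq_nonneg (form a p + form a y)),
      mul_nonneg (sq_nonneg T) (sq_nonneg (form b p + form b y))]
  rw [e3]
  linarith

end IsFarPlane

/-! ### Polygons in the plane -/

/-- The linear form on the plane with value `1` at the unit vector of direction `t`. -/
def dirForm (t p q : ℝ) : ℝ := Real.cos t * p + Real.sin t * q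

theorem dirForm_combination (α β t p q : ℝ) :
    Real.sin (β - α) * dirForm t p q =
      Real.sin (β - t) * dirForm α p q + Real.sin (t - α) * dirForm β p q := by
  simp only [dirForm, Real.sin_sub]
  ring

/-- The inequalities `dirForm (θ l) ≤ b l` describe a bounded polygon that contains the origin in
its interior, and each of them is tight alone at some point of the polygon. -/
structure IsPolygon {I : Type*} (θ b : I → ℝ) : Prop where
  mem : ∀ l, θ l ∈ Set.Ioc (-Real.pi) Real.pi
  pos : ∀ l, 0 < b l
  side : ∀ l, ∃ p q, dirForm (θ l) p q = b l ∧ ∀ m, m ≠ l → dirForm (θ m) p q < b m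
  bounded : ∀ p q, (∀ l, dirForm (θ l) p q ≤ 0) → p = 0 ∧ q = 0

/-- A cyclic enumeration `σ`, of period `k`, of the index set `I` by increasing directions `θ`; here
`φ` lifts the sequence of directions to a strictly increasing sequence of real numbers. -/
structure IsCyclicOrder {I : Type*} (θ : I → ℝ) (k : ℕ) (σ : ℕ → I) (φ : ℕ → ℝ) : Prop where
  pos : 0 < k
  cos_eq : ∀ i, Real.cos (φ i) = Real.cos (θ (σ i))
  sin_eq : ∀ i, Real.sin (φ i) = Real.sin (θ (σ i))
  mono : StrictMono φ
  period : ∀ i, σ (i + k) = σ i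
  lift : ∀ i, φ (i + k) = φ i + 2 * Real.pi
  injOn : Set.InjOn σ (Set.Iio k)
  surj : ∀ l, ∃ i < k, σ i = l

namespace IsCyclicOrder

variable {I : Type*} {θ b : I → ℝ} {k : ℕ} {σ : ℕ → I} {φ : ℕ → ℝ}

theorem dirForm_eq (hc : IsCyclicOrder θ k σ φ) (i : ℕ) (p q : ℝ) :
    dirForm (θ (σ i)) p q = dirForm (φ i) p q := by
  rw [dirForm, dirForm, hc.cos_eq, hc.sin_eq]

theorem apply_mod (hc : IsCyclicOrder θ k σ φ) (i : ℕ) : σ (i % k) = σ i :=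
  (Function.Periodic.map_mod_nat (f := σ) hc.period i)

theorem apply_mod_succ (hc : IsCyclicOrder θ k σ φ) (i : ℕ) : σ (i % k + 1) = σ (i + 1) := by
  rw [← hc.apply_mod (i % k + 1), Nat.mod_add_mod, hc.apply_mod]

theorem mod_eq (hc : IsCyclicOrder θ k σ φ) {i j : ℕ} (h : σ i = σ j) : i % k = j % k := by
  rw [← hc.apply_mod i, ← hc.apply_mod j] at h
  exact hc.injOn (Nat.mod_lt _ hc.pos) (Nat.mod_lt _ hc.pos) h

theorem apply_ne (hc : IsCyclicOrder θ k σ φ) {i j : ℕ} (hij : i < j) (hji : j < i + k) :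
    σ i ≠ σ j := by
  intro h
  have h1 : i ≡ j [MOD k] := hc.mod_eq h
  have h2 := (Nat.modEq_iff_dvd' hij.le).1 h1
  have := Nat.le_of_dvd (by omega) h2
  omega

theorem exists_window (hc : IsCyclicOrder θ k σ φ) (l : I) (i : ℕ) :
    ∃ j, i + 1 ≤ j ∧ j ≤ i + k ∧ σ j = l := by
  obtain ⟨c, hck, rfl⟩ := hc.surj l
  have hk := hc.pos
  have hlt := Nat.mod_lt (c + (k - 1) * (i + 1)) hk
  refine ⟨i + 1 + (c + (k - 1) * (i + 1)) % k, by omega, by omega, ?_⟩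
  rw [← hc.apply_mod, Nat.add_mod_mod]
  have : i + 1 + (c + (k - 1) * (i + 1)) = c + k * (i + 1) := by
    obtain ⟨k, rfl⟩ : ∃ k', k = k' + 1 := ⟨k - 1, by omega⟩
    simp only [Nat.add_sub_cancel]
    ring
  rw [this, Nat.add_mul_mod_self_left, Nat.mod_eq_of_lt hck]

/-- The normal direction of no side lies strictly between two consecutive ones. -/
theorem sin_nonpos (hc : IsCyclicOrder θ k σ φ) (l : I) (i : ℕ)
    (h1 : 0 < Real.sin (θ l - φ i)) : Real.sin (φ (i + 1) - θ l) ≤ 0 := by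
  obtain ⟨j, hj1, hj2, rfl⟩ := hc.exists_window l i
  have e1 : Real.sin (θ (σ j) - φ i) = Real.sin (φ j - φ i) := by
    rw [Real.sin_sub, Real.sin_sub, hc.cos_eq j, hc.sin_eq j]
  have e2 : Real.sin (φ (i + 1) - θ (σ j)) = Real.sin (φ (i + 1) - φ j) := by
    rw [Real.sin_sub, Real.sin_sub, hc.cos_eq j, hc.sin_eq j]
  rw [e1] at h1
  rw [e2]
  have m1 := hc.mono.monotone hj1
  have m2 := hc.mono.monotone hj2
  have m3 : φ i < φ (i + 1) := hc.mono (Nat.lt_succ_self i)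
  rw [hc.lift] at m2
  have hlt : φ j - φ i < Real.pi := by
    by_contra hcon
    push Not at hcon
    have : 0 ≤ Real.sin (φ j - φ i - Real.pi) :=
      Real.sin_nonneg_of_nonneg_of_le_pi (by linarith) (by linarith)
    rw [Real.sin_sub_pi] at this
    linarith
  exact Real.sin_nonpos_of_nonpos_of_neg_pi_le (by linarith) (by linarith)

/-- As the polygon is bounded, the normals of its sides do not all lie in a half-plane. -/
theorem gap_lt_pi (hc : IsCyclicOrder θ k σ φ) (hP : IsPolygon θ b) (i : ℕ) :
    φ (i + 1) - φ i < Real.pi := by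
  by_contra hcon
  push Not at hcon
  have h := hP.bounded (-Real.sin (φ i)) (Real.cos (φ i)) fun l => by
    obtain ⟨j, hj1, hj2, rfl⟩ := hc.exists_window l i
    have m1 := hc.mono.monotone hj1
    have m2 := hc.mono.monotone hj2
    rw [hc.lift] at m2
    have : 0 ≤ Real.sin (φ j - φ i - Real.pi) :=
      Real.sin_nonneg_of_nonneg_of_le_pi (by linarith) (by linarith)
    rw [Real.sin_sub_pi, Real.sin_sub] at this
    rw [hc.dirForm_eq, dirForm]
    linarith
  have := Real.sin_sq_add_cos_sq (φ i)
  rw [h.2, neg_eq_zero.1 h.1] at this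
  norm_num at this

theorem three_le (hc : IsCyclicOrder θ k σ φ) (hP : IsPolygon θ b) : 3 ≤ k := by
  have hsum : ∑ i ∈ Finset.range k, (φ (i + 1) - φ i) = 2 * Real.pi := by
    rw [Finset.sum_range_sub]
    have := hc.lift 0
    rw [zero_add] at this
    linarith
  have hlt : ∑ i ∈ Finset.range k, (φ (i + 1) - φ i) < ∑ i ∈ Finset.range k, Real.pi :=
    Finset.sum_lt_sum_of_nonempty (Finset.nonempty_range_iff.2 hc.pos.ne')
      fun i _ => hc.gap_lt_pi hP i
  rw [hsum, Finset.sum_const, Finset.card_range, nsmul_eq_mul] at hlt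
  have : (2 : ℝ) < k := lt_of_mul_lt_mul_right hlt Real.pi_pos.le
  exact_mod_cast this

/-- Consecutive sides meet in a vertex of the polygon. -/
theorem exists_corner (hc : IsCyclicOrder θ k σ φ) (hP : IsPolygon θ b) (i : ℕ) :
    ∃ p q, dirForm (θ (σ i)) p q = b (σ i) ∧ dirForm (θ (σ (i + 1))) p q = b (σ (i + 1)) ∧
      ∀ m, m ≠ σ i → m ≠ σ (i + 1) → dirForm (θ m) p q < b m := by
  have hD : 0 < Real.sin (φ (i + 1) - φ i) :=
    Real.sin_pos_of_pos_of_lt_pi (by linarith [hc.mono (Nat.lt_succ_self i)]) (hc.gap_lt_pi hP i)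
  set D := Real.sin (φ (i + 1) - φ i) with hDdef
  have hD' := hDdef
  rw [Real.sin_sub] at hD'
  let p := (b (σ i) * Real.sin (φ (i + 1)) - b (σ (i + 1)) * Real.sin (φ i)) / D
  let q := (b (σ (i + 1)) * Real.cos (φ i) - b (σ i) * Real.cos (φ (i + 1))) / D
  have e1 : dirForm (φ i) p q = b (σ i) := by
    simp only [dirForm, p, q]
    field_simp
    rw [hD']
    ring
  have e2 : dirForm (φ (i + 1)) p q = b (σ (i + 1)) := by
    simp only [dirForm, p, q]
    field_simp
    rw [hD']
    ring
  refine ⟨p, q, by rw [hc.dirForm_eq, e1], by rw [hc.dirForm_eq, e2], fun m hm1 hm2 => ?_⟩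
  by_contra hcon
  push Not at hcon
  have hcomb := dirForm_combination (φ i) (φ (i + 1)) (θ m)
  -- by comparison with the points on the two sides, the normal of `m` would lie between
  have hν : 0 < Real.sin (θ m - φ i) := by
    obtain ⟨x, y, hx, hlt⟩ := hP.side (σ i)
    have h1 := hcomb p q
    have h2 := hcomb x y
    rw [hc.dirForm_eq] at hx
    have h3 := hlt m hm1
    have h4 := hlt (σ (i + 1)) (fun h0 => hc.apply_ne (i := i) (j := i + 1) (by omega)
      (by have := hc.three_le hP; omega) h0.symm)
    rw [hc.dirForm_eq] at h4
    rw [e1, e2] at h1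
    rw [hx] at h2
    by_contra hneg
    push Not at hneg
    nlinarith [mul_lt_mul_of_pos_left (lt_of_lt_of_le h3 hcon) hD,
      mul_nonneg (neg_nonneg.2 hneg) (sub_nonneg.2 h4.le)]
  have hμ : 0 < Real.sin (φ (i + 1) - θ m) := by
    obtain ⟨x, y, hx, hlt⟩ := hP.side (σ (i + 1))
    have h1 := hcomb p q
    have h2 := hcomb x y
    rw [hc.dirForm_eq] at hx
    have h3 := hlt m hm2
    have h4 := hlt (σ i) (fun h0 => hc.apply_ne (i := i) (j := i + 1) (by omega)
      (by have := hc.three_le hP; omega) h0)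
    rw [hc.dirForm_eq] at h4
    rw [e1, e2] at h1
    rw [hx] at h2
    by_contra hneg
    push Not at hneg
    nlinarith [mul_lt_mul_of_pos_left (lt_of_lt_of_le h3 hcon) hD,
      mul_nonneg (neg_nonneg.2 hneg) (sub_nonneg.2 h4.le)]
  linarith [hc.sin_nonpos m i hν]

/-- Two sides that meet and whose normals make an oriented angle less than `π` are consecutive. -/
theorem eq_succ_of_corner (hc : IsCyclicOrder θ k σ φ) (hP : IsPolygon θ b) {s t : ℕ}
    (hst : s < t) (hts : t < s + k) (hlt : φ t - φ s < Real.pi) {p q : ℝ}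
    (hle : ∀ l, dirForm (θ l) p q ≤ b l) (h1 : dirForm (θ (σ s)) p q = b (σ s))
    (h2 : dirForm (θ (σ t)) p q = b (σ t)) : t = s + 1 := by
  by_contra hne
  have hst1 : s + 1 < t := by omega
  have m1 : φ s < φ (s + 1) := hc.mono (Nat.lt_succ_self s)
  have m2 : φ (s + 1) < φ t := hc.mono hst1
  have hD : 0 < Real.sin (φ t - φ s) := Real.sin_pos_of_pos_of_lt_pi (by linarith) hlt
  have hμ : 0 < Real.sin (φ t - φ (s + 1)) :=
    Real.sin_pos_of_pos_of_lt_pi (by linarith) (by linarith)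
  have hν : 0 < Real.sin (φ (s + 1) - φ s) :=
    Real.sin_pos_of_pos_of_lt_pi (by linarith) (by linarith)
  have hcomb := dirForm_combination (φ s) (φ t) (φ (s + 1))
  obtain ⟨x, y, hx, hside⟩ := hP.side (σ (s + 1))
  have i1 := hside (σ s) (hc.apply_ne (by omega) (by omega))
  have i2 := hside (σ t) fun h0 => hc.apply_ne (i := s + 1) (j := t) hst1 (by omega) h0.symm
  have i3 := hle (σ (s + 1))
  have c1 := hcomb p q
  have c2 := hcomb x y
  rw [hc.dirForm_eq] at h1 h2 hx i1 i2 i3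
  rw [h1, h2] at c1
  rw [hx] at c2
  nlinarith [mul_lt_mul_of_pos_left i1 hμ, mul_lt_mul_of_pos_left i2 hν,
    mul_le_mul_of_nonneg_left i3 hD.le]

/-- Two sides that meet are consecutive. -/
theorem exists_consecutive (hc : IsCyclicOrder θ k σ φ) (hP : IsPolygon θ b) {l m : I}
    (hlm : l ≠ m) {p q : ℝ} (hle : ∀ l, dirForm (θ l) p q ≤ b l)
    (h1 : dirForm (θ l) p q = b l) (h2 : dirForm (θ m) p q = b m) :
    ∃ i < k, (σ i = l ∧ σ (i + 1) = m) ∨ (σ i = m ∧ σ (i + 1) = l) := by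
  obtain ⟨s, hs, rfl⟩ := hc.surj l
  obtain ⟨t, ht1, ht2, rfl⟩ := hc.exists_window m s
  have htk : t < s + k := lt_of_le_of_ne ht2 fun h0 => hlm (by rw [h0, hc.period])
  rcases lt_trichotomy (φ t - φ s) Real.pi with hlt | heq | hgt
  · have := hc.eq_succ_of_corner hP (by omega) htk hlt hle h1 h2
    subst this
    exact ⟨s, hs, Or.inl ⟨rfl, rfl⟩⟩
  · exfalso
    have e1 : φ t = φ s + Real.pi := by linarith
    have p1 := hP.pos (σ s)
    have p2 := hP.pos (σ t)
    rw [hc.dirForm_eq] at h1 h2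
    rw [e1] at h2
    simp only [dirForm, Real.cos_add_pi, Real.sin_add_pi] at h1 h2
    linarith
  · have := hc.eq_succ_of_corner hP (s := t) (t := s + k) htk (by omega)
      (by rw [hc.lift]; linarith) hle h2 (by rw [hc.period, h1])
    refine ⟨t % k, Nat.mod_lt _ hc.pos, Or.inr ⟨hc.apply_mod t, ?_⟩⟩
    rw [hc.apply_mod_succ, ← this, hc.period]

end IsCyclicOrder

theorem IsPolygon.injective {I : Type*} {θ b : I → ℝ} (hP : IsPolygon θ b) :
    Function.Injective θ := by
  intro l m h
  by_contra hne
  obtain ⟨p, q, h1, h2⟩ := hP.side l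
  obtain ⟨p', q', h3, h4⟩ := hP.side m
  have h5 := h2 m (Ne.symm hne)
  have h6 := h4 l hne
  rw [← h] at h3 h5
  linarith

theorem IsPolygon.exists_isCyclicOrder {I : Type*} [Fintype I] [Nonempty I] {θ b : I → ℝ}
    (hP : IsPolygon θ b) : ∃ σ φ, IsCyclicOrder θ (Fintype.card I) σ φ := by
  have hk : 0 < Fintype.card I := Fintype.card_pos
  set k := Fintype.card I with hkdef
  let e₀ := Fintype.equivFin I
  let e : Fin k ≃ I := (Tuple.sort (θ ∘ e₀.symm)).trans e₀.symm
  have hmono : StrictMono (θ ∘ e) :=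
    (Tuple.monotone_sort (θ ∘ e₀.symm)).strictMono_of_injective
      (hP.injective.comp e.injective)
  let σ : ℕ → I := fun i => e ⟨i % k, Nat.mod_lt _ hk⟩
  let φ : ℕ → ℝ := fun i => θ (σ i) + (i / k : ℕ) * (2 * Real.pi)
  have hperiod : ∀ i, σ (i + k) = σ i := fun i => by
    simp only [σ, Nat.add_mod_right]
  refine ⟨σ, φ, hk, fun i => Real.cos_add_nat_mul_two_pi _ _,
    fun i => Real.sin_add_nat_mul_two_pi _ _, strictMono_nat_of_lt_succ fun i => ?_, hperiod,
    fun i => ?_, ?_, fun l => ?_⟩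
  · have hlt := Nat.mod_lt i hk
    have hdm := Nat.div_add_mod i k
    rcases Nat.lt_or_ge (i % k + 1) k with h1 | h1
    · have hd : (i + 1) / k = i / k := by
        rw [← hdm, add_assoc, Nat.mul_add_div hk, Nat.mul_add_div hk, Nat.div_eq_of_lt h1,
          Nat.div_eq_of_lt hlt]
      have hm : (i + 1) % k = i % k + 1 := by
        conv_lhs => rw [← hdm, add_assoc, Nat.mul_add_mod, Nat.mod_eq_of_lt h1]
      simp only [φ, hd]
      have : θ (σ i) < θ (σ (i + 1)) := hmono (Fin.mk_lt_mk.2 (by omega))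
      linarith
    · have hd : (i + 1) / k = i / k + 1 := by
        have : i + 1 = k * (i / k + 1) := by rw [mul_add]; omega
        rw [this, Nat.mul_div_cancel_left _ hk]
      have b1 := (hP.mem (σ i)).2
      have b2 := (hP.mem (σ (i + 1))).1
      simp only [φ, hd]
      push_cast
      linarith
  · simp only [φ, hperiod, Nat.add_div_right i hk]
    push_cast
    ring
  · intro i hi j hj hij
    have := e.injective hij
    rw [Fin.mk.injEq, Nat.mod_eq_of_lt hi, Nat.mod_eq_of_lt hj] at this
    exact this
  · refine ⟨e.symm l, (e.symm l).2, ?_⟩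
    simp only [σ, Nat.mod_eq_of_lt (e.symm l).2]
    exact e.apply_symm_apply l

/-! ### The section of a polyhedron by a plane -/

open Classical in
/-- The facet normals of the faces that meet the plane with normal `n`. -/
def crossing (X : Set Vec) (S : Finset Vec) (n : Vec) : Finset Vec :=
  S.filter fun m => (faceSet X {m} ∩ plane n).Nonempty

theorem mem_crossing {X : Set Vec} {S : Finset Vec} {n m : Vec} :
    m ∈ crossing X S n ↔ m ∈ S ∧ ∃ y ∈ X, form m y = 0 ∧ form n y = 0 ∧ y ∈ space := by
  classical
  rw [crossing, Finset.mem_filter]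
  refine and_congr_right fun _ => ⟨?_, ?_⟩
  · rintro ⟨y, hy, hyn⟩
    exact ⟨y, hy.1, hy.2 m rfl, hyn.2, hyn.1⟩
  · rintro ⟨y, hy, h1, h2, h3⟩
    exact ⟨y, ⟨hy, by simpa using h1⟩, h3, h2⟩

theorem IsPresentation.mem_crossing_of {X : Set Vec} {S : Finset Vec} (h : IsPresentation X S)
    {n m y : Vec} (hm : m ∈ S) (hy : y ∈ X) (hmy : form m y = 0) (hny : form n y = 0) :
    m ∈ crossing X S n :=
  mem_crossing.2 ⟨hm, y, hy, hmy, hny, h.subset_space hy⟩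

/-- A face that meets a far plane has vertices on both sides of it. -/
theorem exists_signed_vertices {X : Set Vec} {S : Finset Vec} {n o : Vec} {T : ℝ}
    (h : IsPresentation X S) (hP : IsFarPlane X n o T) {m : Vec} (hm : m ∈ crossing X S n) :
    ∃ w₁ ∈ vertices X, ∃ w₂ ∈ vertices X, form m w₁ = 0 ∧ form m w₂ = 0 ∧
      0 < form n w₁ ∧ form n w₂ < 0 := by
  obtain ⟨hmS, y, hy, hmy, hny, hys⟩ := mem_crossing.1 hm
  have hy0 := ne_zero_of_future (space_subset_future hys)
  obtain ⟨w₂, hw₂, hle₂, hact₂⟩ := h.exists_vertex_nonpos (bilin n) (h.mem_iff.1 hy).2 hy0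
    (by rw [bilin_apply, hny])
  obtain ⟨w₁, hw₁, hle₁, hact₁⟩ := h.exists_vertex_nonpos (-bilin n) (h.mem_iff.1 hy).2 hy0
    (by rw [LinearMap.neg_apply, bilin_apply, hny, neg_zero])
  rw [LinearMap.neg_apply, bilin_apply] at hle₁
  rw [bilin_apply] at hle₂
  exact ⟨w₁, hw₁, w₂, hw₂, hact₁ m hmS hmy, hact₂ m hmS hmy,
    lt_of_le_of_ne (by linarith) (hP.form_ne_zero h hw₁).symm,
    lt_of_le_of_ne hle₂ (hP.form_ne_zero h hw₂)⟩

theorem form_sq_le_of_crossing {X : Set Vec} {S : Finset Vec} {n o : Vec} {T : ℝ}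
    (h : IsPresentation X S) (hP : IsFarPlane X n o T) {m : Vec} (hm : m ∈ crossing X S n) :
    form m n ^ 2 ≤ 1 - T ^ 2 := by
  obtain ⟨w₁, hw₁, w₂, hw₂, h1, h2, h3, h4⟩ := exists_signed_vertices h hP hm
  have f1 := hP.far w₁ hw₁
  have f2 := hP.far w₂ hw₂
  rw [abs_of_pos h3] at f1
  rw [abs_of_neg h4] at f2
  exact hP.form_sq_le (h.unit m (mem_crossing.1 hm).1)
    (h.subset_space (vertex_mem hw₁))
    (h.subset_space (vertex_mem hw₂)) h1 h2 f1 f2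

/-- As the plane avoids the vertices, it meets each face that it crosses in a relatively interior
point. -/
theorem exists_section_point {X : Set Vec} {S : Finset Vec} {n o : Vec} {T : ℝ}
    (h : IsPresentation X S) (hP : IsFarPlane X n o T) {m : Vec} (hm : m ∈ crossing X S n) :
    ∃ x ∈ X, form n x = 0 ∧ form m x = 0 ∧ ∀ l ∈ S, l ≠ m → form l x < 0 := by
  obtain ⟨w₁, hw₁, w₂, hw₂, h1, h2, h3, h4⟩ := exists_signed_vertices h hP hm
  have hmS := (mem_crossing.1 hm).1
  obtain ⟨f, hf, hmf, hlt⟩ := h.exists_facet_point hmS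
  have step : ∀ w ∈ vertices X, form m w = 0 → ∀ c d : ℝ, 0 < c → 0 ≤ d →
      c * form n f + d * form n w = 0 →
      ∃ x ∈ X, form n x = 0 ∧ form m x = 0 ∧ ∀ l ∈ S, l ≠ m → form l x < 0 := by
    intro w hw hmw c d hc hd h0
    have hwX := vertex_mem hw
    have hfut : c • f + d • w ∈ future := by
      have h5 := future_smul (space_subset_future (h.subset_space hf)) hc
      rcases hd.eq_or_lt with rfl | hd
      · simpa using h5
      · exact future_add h5 (future_smul (space_subset_future (h.subset_space hwX)) hd)
    have hneg : ∀ l ∈ S, l ≠ m → form l (c • f + d • w) < 0 := by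
      intro l hl hlm
      rw [form_add_right, form_smul_right, form_smul_right]
      have := mul_neg_of_pos_of_neg hc (hlt l hl hlm)
      have := mul_nonpos_of_nonneg_of_nonpos hd (h.form_nonpos hl hwX)
      linarith
    have hzero : form m (c • f + d • w) = 0 := by
      rw [form_add_right, form_smul_right, form_smul_right, hmf, hmw]; ring
    obtain ⟨e, he, hes⟩ := h.exists_smul_mem (x := c • f + d • w) (fun l hl => by
      by_cases hlm : l = m
      · rw [hlm, hzero]
      · exact (hneg l hl hlm).le) (ne_zero_of_future hfut)
    refine ⟨_, hes, ?_, ?_, fun l hl hlm => ?_⟩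
    · rw [form_smul_right, form_add_right, form_smul_right, form_smul_right, h0, mul_zero]
    · rw [form_smul_right, hzero, mul_zero]
    · rw [form_smul_right]
      exact mul_neg_of_pos_of_neg he (hneg l hl hlm)
  rcases le_total 0 (form n f) with h5 | h5
  · exact step w₂ hw₂ h2 (-form n w₂) (form n f) (by linarith) h5 (by ring)
  · exact step w₁ hw₁ h1 (form n w₁) (-form n f) h3 (by linarith) (by ring)

/-- A plane that separates two points of a polyhedron contains interior points of it. -/
theorem IsPresentation.exists_interior_section {X : Set Vec} {S : Finset Vec}
    (h : IsPresentation X S) {n u v : Vec} (hu : u ∈ X) (hv : v ∈ X) (hnu : form n u < 0)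
    (hnv : 0 < form n v) : ∃ p ∈ X, form n p = 0 ∧ ∀ m ∈ S, form m p < 0 := by
  obtain ⟨f, hf, hlt⟩ := h.exists_interior
  have step : ∀ w ∈ X, ∀ c d : ℝ, 0 < c → 0 ≤ d → c * form n f + d * form n w = 0 →
      ∃ p ∈ X, form n p = 0 ∧ ∀ m ∈ S, form m p < 0 := by
    intro w hw c d hc hd h0
    have hfut : c • f + d • w ∈ future := by
      have h5 := future_smul (space_subset_future (h.subset_space hf)) hc
      rcases hd.eq_or_lt with rfl | hd
      · simpa using h5
      · exact future_add h5 (future_smul (space_subset_future (h.subset_space hw)) hd)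
    have hneg : ∀ l ∈ S, form l (c • f + d • w) < 0 := by
      intro l hl
      rw [form_add_right, form_smul_right, form_smul_right]
      have := mul_neg_of_pos_of_neg hc (hlt l hl)
      have := mul_nonpos_of_nonneg_of_nonpos hd (h.form_nonpos hl hw)
      linarith
    obtain ⟨e, he, hes⟩ := h.exists_smul_mem (fun l hl => (hneg l hl).le) (ne_zero_of_future hfut)
    refine ⟨_, hes, ?_, fun l hl => ?_⟩
    · rw [form_smul_right, form_add_right, form_smul_right, form_smul_right, h0, mul_zero]
    · rw [form_smul_right]
      exact mul_neg_of_pos_of_neg he (hneg l hl)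
  rcases le_total 0 (form n f) with h5 | h5
  · exact step u hu (-form n u) (form n f) (by linarith) h5 (by ring)
  · exact step v hv (form n v) (-form n f) hnv (by linarith) (by ring)

/-- An orthonormal frame `a`, `b` of a far plane at an interior point `p` of the polyhedron. -/
structure SectionFrame (X : Set Vec) (S : Finset Vec) (n o : Vec) (T : ℝ) (p a b : Vec) :
    Prop where
  pres : IsPresentation X S
  isFar : IsFarPlane X n o T
  mem : p ∈ X
  form_n_p : form n p = 0
  interior : ∀ m ∈ S, form m p < 0
  form_p_a : form p a = 0
  form_p_b : form p b = 0
  form_n_a : form n a = 0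
  form_n_b : form n b = 0
  form_a_a : form a a = 1
  form_b_b : form b b = 1
  form_a_b : form a b = 0
  expand : ∀ x y, form x y = -(form p x * form p y) + form n x * form n y +
    form a x * form a y + form b x * form b y

/-- The direction in the frame `a`, `b` of the projection of `m`. -/
def normalAngle (a b m : Vec) : ℝ := Complex.arg ⟨form a m, form b m⟩

/-- The length of the projection of `m` to the span of the frame `a`, `b`. -/
def normalLength (a b m : Vec) : ℝ := ‖(⟨form a m, form b m⟩ : ℂ)‖

/-- The distance from `p` to the side with normal `m`, in the projective model centred at `p`. -/
def offset (p a b m : Vec) : ℝ := -form p m / normalLength a b m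

theorem form_left_eq (a b m : Vec) :
    form a m = normalLength a b m * Real.cos (normalAngle a b m) :=
  (Complex.norm_mul_cos_arg (⟨form a m, form b m⟩ : ℂ)).symm

theorem form_right_eq (a b m : Vec) :
    form b m = normalLength a b m * Real.sin (normalAngle a b m) :=
  (Complex.norm_mul_sin_arg (⟨form a m, form b m⟩ : ℂ)).symm

theorem IsPresentation.finrank_orthSet_pair {X : Set Vec} {S : Finset Vec}
    (h : IsPresentation X S) {m l : Vec} (hm : m ∈ S) (hl : l ∈ S) (hne : m ≠ l) :
    Module.finrank ℝ (orthSet {m, l}) = 2 := by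
  have hinf : orthSet {m, l} = orth m ⊓ orth l := by
    ext x; simp [mem_orthSet]
  have hm3 := finrank_orth (h.ne_zero hm)
  have hl3 := finrank_orth (h.ne_zero hl)
  have hlt : orth m < orth m ⊔ orth l := by
    refine lt_of_le_of_ne le_sup_left fun heq => hne (h.facet_injOn hm hl ?_)
    have hle : orth l ≤ orth m := by rw [heq]; exact le_sup_right
    have heq' := Submodule.eq_of_le_of_finrank_eq hle (by rw [hm3, hl3])
    ext x
    have : x ∈ orth l ↔ x ∈ orth m := by rw [heq']
    simp only [mem_orth] at this
    simp [faceSet, this]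
  have h1 := Submodule.finrank_lt_finrank_of_lt hlt
  have h2 := Submodule.finrank_le (orth m ⊔ orth l)
  have h3 := Submodule.finrank_sup_add_finrank_inf_eq (orth m) (orth l)
  have h4 : Module.finrank ℝ Vec = 4 := by simp
  rw [hinf]
  omega

theorem faceSet_pair (X : Set Vec) (m l : Vec) :
    faceSet X {m, l} = faceSet X {m} ∩ faceSet X {l} := by
  ext x
  simp only [faceSet, Set.mem_inter_iff]
  constructor
  · rintro ⟨h1, h2⟩
    exact ⟨⟨h1, fun k hk => h2 k (Or.inl hk)⟩, h1, fun k hk => h2 k (Or.inr hk)⟩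
  · rintro ⟨⟨h1, h2⟩, -, h3⟩
    exact ⟨h1, fun k hk => hk.elim (h2 k) (h3 k)⟩

/-- Two faces whose inequalities alone are tight at some point meet in an edge. -/
theorem IsPresentation.isEdge_inter {X : Set Vec} {S : Finset Vec} (h : IsPresentation X S)
    {m l y : Vec} (hm : m ∈ S) (hl : l ∈ S) (hne : m ≠ l) (hy : y ∈ X) (hmy : form m y = 0)
    (hly : form l y = 0) (hlt : ∀ k ∈ S, k ≠ m → k ≠ l → form k y < 0) :
    IsEdge X (faceSet X {m} ∩ faceSet X {l}) := by
  classical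
  rw [← faceSet_pair]
  have hyf : y ∈ faceSet X {m, l} := by
    rw [faceSet_pair]; exact ⟨⟨hy, by simpa using hmy⟩, hy, by simpa using hly⟩
  constructor
  · have := h.exists_outwardNormal (A := {m, l}) (by
      intro k hk
      rcases Finset.mem_insert.1 hk with rfl | hk
      · exact hm
      · rw [Finset.mem_singleton.1 hk]; exact hl) ⟨m, Finset.mem_insert_self _ _⟩ (y := y)
      (by simpa using hyf)
    simpa using this
  · rw [h.span_faceSet hyf fun k hk hkn => hlt k hk (fun h0 => hkn (Or.inl h0))
      (fun h0 => hkn (Or.inr h0)), h.finrank_orthSet_pair hm hl hne]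

/-- An edge is the intersection of two faces. -/
theorem IsPresentation.exists_faces_of_isEdge {X : Set Vec} {S : Finset Vec}
    (h : IsPresentation X S) {d : Set Vec} (hd : IsEdge X d) :
    ∃ m ∈ S, ∃ l ∈ S, m ≠ l ∧ d = faceSet X {m} ∩ faceSet X {l} := by
  obtain ⟨⟨k, hk⟩, hdim⟩ := id hd
  obtain ⟨A, hA, hdA, hspan, -⟩ := h.exists_generic hk (nonempty_of_isFaceOfDim hd)
  rw [hspan] at hdim
  have hcard : 1 < A.card := by
    by_contra hcon
    push Not at hcon
    obtain ⟨m, hAm⟩ := Finset.card_le_one_iff_subset_singleton.1 hcon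
    have hle : orth m ≤ orthSet (A : Set Vec) := fun x hx k hk => by
      rw [Finset.mem_singleton.1 (hAm hk)]; exact hx
    have h1 := Submodule.finrank_mono hle
    by_cases hm0 : m = 0
    · have : orth m = ⊤ := by rw [hm0, eq_top_iff]; intro x _; simp
      rw [this, finrank_top, hdim] at h1
      simp at h1
    · rw [finrank_orth hm0, hdim] at h1
      omega
  obtain ⟨m, hm, l, hl, hne⟩ := Finset.one_lt_card.1 hcard
  refine ⟨m, hA hm, l, hA hl, hne, ?_⟩
  have hle : orthSet (A : Set Vec) ≤ orthSet {m, l} := fun x hx k hk => by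
    rcases hk with rfl | hk
    · exact hx _ hm
    · rw [Set.mem_singleton_iff.1 hk]; exact hx _ hl
  have heq := Submodule.eq_of_le_of_finrank_eq hle
    (by rw [hdim, h.finrank_orthSet_pair (hA hm) (hA hl) hne])
  rw [← faceSet_pair, hdA]
  ext x
  have : x ∈ orthSet (A : Set Vec) ↔ x ∈ orthSet {m, l} := by rw [heq]
  exact and_congr_right fun _ => this

namespace SectionFrame

variable {X : Set Vec} {S : Finset Vec} {n o p a b : Vec} {T : ℝ}

theorem mem_space (F : SectionFrame X S n o T p a b) : p ∈ space := F.pres.subset_space F.mem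

theorem sq_normalLength (F : SectionFrame X S n o T p a b) {m : Vec} (hm : m ∈ S) :
    normalLength a b m ^ 2 = 1 - form m n ^ 2 + form p m ^ 2 := by
  have h := F.expand m m
  rw [F.pres.unit m hm, form_left_eq a b m, form_right_eq a b m] at h
  rw [form_comm m n]
  linear_combination -h - normalLength a b m ^ 2 * Real.sin_sq_add_cos_sq (normalAngle a b m)

theorem form_p_neg (F : SectionFrame X S n o T p a b) {m : Vec} (hm : m ∈ S) : form p m < 0 := by
  rw [form_comm]; exact F.interior m hm

theorem normalLength_pos (F : SectionFrame X S n o T p a b) {m : Vec} (hm : m ∈ crossing X S n) :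
    0 < normalLength a b m := by
  have h1 := F.sq_normalLength (mem_crossing.1 hm).1
  have h2 := form_sq_le_of_crossing F.pres F.isFar hm
  have h3 := F.isFar.pos
  have h4 : 0 ≤ normalLength a b m := norm_nonneg _
  refine lt_of_le_of_ne h4 fun h0 => ?_
  rw [← h0] at h1
  nlinarith [sq_nonneg (form p m)]

/-- The value of a facet inequality at a point of the section, in affine coordinates. -/
theorem form_eq (F : SectionFrame X S n o T p a b) {m x : Vec} (hm : m ∈ crossing X S n)
    (hx : form n x = 0) (hpx : form p x < 0) :
    form m x = normalLength a b m * -form p x *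
      (dirForm (normalAngle a b m) (form a x / -form p x) (form b x / -form p x) -
        offset p a b m) := by
  have hr := F.normalLength_pos hm
  rw [F.expand m x, hx, form_left_eq a b m, form_right_eq a b m, dirForm, offset]
  have : form p x ≠ 0 := hpx.ne
  field_simp
  ring

/-- The faces that meet the plane determine the section. -/
theorem mem_polyCone_of_crossing (F : SectionFrame X S n o T p a b) {x : Vec}
    (hx : form n x = 0) (hpx : form p x ≤ 0) (hle : ∀ m ∈ crossing X S n, form m x ≤ 0) :
    x ∈ polyCone S := by
  by_contra hxS
  obtain ⟨t, ht, htS, m, hm, -, h0⟩ := exists_exit (F.pres.mem_iff.1 F.mem).2 hxS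
    (fun m hm h0 => absurd h0 (F.interior m hm).ne)
  have hne : p + t • x ≠ 0 := by
    intro h1
    have h2 := congrArg (form p) h1
    rw [form_add_right, form_smul_right, F.mem_space.1, form_zero_right] at h2
    have := mul_nonpos_of_nonneg_of_nonpos ht.le hpx
    linarith
  obtain ⟨c, hc, hcX⟩ := F.pres.exists_smul_mem htS hne
  have hmc := F.pres.mem_crossing_of (n := n) hm hcX (by rw [form_smul_right, h0, mul_zero])
    (by rw [form_smul_right, form_add_right, form_smul_right, F.form_n_p, hx]; ring)
  have h1 := mul_nonpos_of_nonneg_of_nonpos ht.le (hle m hmc)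
  rw [form_add_right, form_smul_right] at h0
  linarith [F.interior m hm]

theorem isPolygon (F : SectionFrame X S n o T p a b) :
    IsPolygon (fun m : crossing X S n => normalAngle a b m) (fun m => offset p a b m) where
  mem := fun m => Complex.arg_mem_Ioc _
  pos := fun m => div_pos (neg_pos.2 (F.form_p_neg (mem_crossing.1 m.2).1))
    (F.normalLength_pos m.2)
  side := by
    rintro ⟨m, hm⟩
    obtain ⟨x, hx, hnx, hmx, hlt⟩ := exists_section_point F.pres F.isFar hm
    have hpx := form_neg_of_space F.mem_space (F.pres.subset_space hx)
    refine ⟨form a x / -form p x, form b x / -form p x, ?_, ?_⟩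
    · have h1 := F.form_eq hm hnx hpx
      have h2 := mul_pos (F.normalLength_pos hm) (neg_pos.2 hpx)
      rw [hmx] at h1
      exact sub_eq_zero.1 ((mul_eq_zero.1 h1.symm).resolve_left h2.ne')
    · rintro ⟨l, hl⟩ hlm
      have h1 := F.form_eq hl hnx hpx
      have h2 := mul_pos (F.normalLength_pos hl) (neg_pos.2 hpx)
      have h3 := hlt l (mem_crossing.1 hl).1 fun h0 => hlm (Subtype.ext h0)
      rw [h1] at h3
      exact sub_neg.1 ((pos_iff_neg_of_mul_neg h3).1 h2)
  bounded := by
    intro s t hst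
    have e1 : form n (s • a + t • b) = 0 := by
      rw [form_add_right, form_smul_right, form_smul_right, F.form_n_a, F.form_n_b]; ring
    have e2 : form p (s • a + t • b) = 0 := by
      rw [form_add_right, form_smul_right, form_smul_right, F.form_p_a, F.form_p_b]; ring
    have hmem : s • a + t • b ∈ polyCone S := F.mem_polyCone_of_crossing e1 e2.le fun m hm => by
      have h1 := hst ⟨m, hm⟩
      have h2 : form m (s • a + t • b) =
          normalLength a b m * dirForm (normalAngle a b m) s t := by
        rw [form_add_right, form_smul_right, form_smul_right, form_comm m a, form_comm m b,
          form_left_eq a b m, form_right_eq a b m, dirForm]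
        ring
      rw [h2]
      exact mul_nonpos_of_nonneg_of_nonpos (norm_nonneg _) h1
    have h0 : s • a + t • b = 0 := by
      by_contra hne
      exact F.pres.not_mem_polyCone F.mem_space e2 hne hmem
    have e3 := congrArg (form a) h0
    have e4 := congrArg (form b) h0
    simp only [form_add_right, form_smul_right, F.form_a_a, F.form_a_b, F.form_b_b,
      form_comm b a, form_zero_right] at e3 e4
    constructor <;> linarith

theorem nonempty_crossing (F : SectionFrame X S n o T p a b) : Nonempty (crossing X S n) := by
  by_contra hne
  rw [not_nonempty_iff] at hne
  have := (F.isPolygon.bounded 1 0 fun l => isEmptyElim l).1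
  norm_num at this

/-- A vertex of the section polygon is a point at which exactly two facet inequalities are
tight. -/
theorem exists_corner_point (F : SectionFrame X S n o T p a b) {m l : crossing X S n} {s t : ℝ}
    (hm : dirForm (normalAngle a b m) s t = offset p a b m)
    (hl : dirForm (normalAngle a b l) s t = offset p a b l)
    (hlt : ∀ k : crossing X S n, k ≠ m → k ≠ l →
      dirForm (normalAngle a b k) s t < offset p a b k) :
    ∃ y ∈ X, form n y = 0 ∧ form m y = 0 ∧ form l y = 0 ∧
      ∀ k ∈ S, k ≠ (m : Vec) → k ≠ (l : Vec) → form k y < 0 := by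
  let x := p + (s • a + t • b)
  have e1 : form n x = 0 := by
    simp only [x, form_add_right, form_smul_right, F.form_n_a, F.form_n_b, F.form_n_p]; ring
  have e2 : form p x = -1 := by
    simp only [x, form_add_right, form_smul_right, F.form_p_a, F.form_p_b, F.mem_space.1]; ring
  have e3 : form a x = s := by
    simp only [x, form_add_right, form_smul_right, form_comm a p, F.form_p_a, F.form_a_a,
      F.form_a_b]
    ring
  have e4 : form b x = t := by
    simp only [x, form_add_right, form_smul_right, form_comm b p, F.form_p_b, form_comm b a,
      F.form_b_b, F.form_a_b]
    ring
  have hform : ∀ k ∈ crossing X S n,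
      form k x = normalLength a b k * (dirForm (normalAngle a b k) s t - offset p a b k) := by
    intro k hk
    rw [F.form_eq hk e1 (by rw [e2]; norm_num), e2, e3, e4]
    norm_num
  have hm0 : form m x = 0 := by rw [hform m m.2, hm, sub_self, mul_zero]
  have hl0 : form l x = 0 := by rw [hform l l.2, hl, sub_self, mul_zero]
  have hneg : ∀ k ∈ crossing X S n, k ≠ (m : Vec) → k ≠ (l : Vec) → form k x < 0 := by
    intro k hk hkm hkl
    rw [hform k hk]
    exact mul_neg_of_pos_of_neg (F.normalLength_pos hk) (sub_neg.2
      (hlt ⟨k, hk⟩ (fun h0 => hkm (congrArg Subtype.val h0))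
        (fun h0 => hkl (congrArg Subtype.val h0))))
  have hx0 : x ≠ 0 := by
    intro h0
    rw [h0, form_zero_right] at e2
    norm_num at e2
  obtain ⟨c, hc, hcX⟩ := F.pres.exists_smul_mem (F.mem_polyCone_of_crossing e1
    (by rw [e2]; norm_num) fun k hk => by
      by_cases h1 : k = m
      · rw [h1, hm0]
      · by_cases h2 : k = l
        · rw [h2, hl0]
        · exact (hneg k hk h1 h2).le) hx0
  have en : form n (c • x) = 0 := by rw [form_smul_right, e1, mul_zero]
  refine ⟨c • x, hcX, en, by rw [form_smul_right, hm0, mul_zero],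
    by rw [form_smul_right, hl0, mul_zero], fun k hk hkm hkl => ?_⟩
  refine lt_of_le_of_ne (F.pres.form_nonpos hk hcX) fun h0 => ?_
  have hkc := F.pres.mem_crossing_of hk hcX h0 en
  rw [form_smul_right] at h0
  exact (mul_neg_of_pos_of_neg hc (hneg k hkc hkm hkl)).ne h0

end SectionFrame

/-! ### The dihedral angles along the section -/

/-- Parallel transport, along the geodesic from `p` to `y`, of a tangent vector `x` at `p`. -/
def transport (p y x : Vec) : Vec := x + (form y x / (1 - form p y)) • (p + y)

theorem form_transport {p y x : Vec} (hp : p ∈ space) (hy : y ∈ space) :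
    form y (transport p y x) = 0 := by
  have h : 1 - form p y ≠ 0 := by linarith [form_le_neg_one hp hy]
  simp only [transport, form_add_right, form_smul_right, form_comm y p, hy.1]
  field_simp
  ring

theorem form_transport_transport {p y x x' : Vec} (hp : p ∈ space) (hy : y ∈ space)
    (hx : form p x = 0) (hx' : form p x' = 0) :
    form (transport p y x) (transport p y x') = form x x' := by
  have h : 1 - form p y ≠ 0 := by linarith [form_le_neg_one hp hy]
  simp only [transport, form_add_right, form_add_left, form_smul_right, form_smul_left,
    form_comm y p, hy.1, hp.1, hx', form_comm x p, hx, form_comm x y]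
  field_simp
  ring

/-- The unit tangent vector at `p` in the direction of the projection of `m`. -/
def direction (a b m : Vec) : Vec :=
  Real.cos (normalAngle a b m) • a + Real.sin (normalAngle a b m) • b

namespace SectionFrame

variable {X : Set Vec} {S : Finset Vec} {n o p a b : Vec} {T : ℝ}

theorem form_p_direction (F : SectionFrame X S n o T p a b) (m : Vec) :
    form p (direction a b m) = 0 := by
  simp only [direction, form_add_right, form_smul_right, F.form_p_a, F.form_p_b]; ring

theorem form_direction (F : SectionFrame X S n o T p a b) (m l : Vec) :
    form (direction a b m) (direction a b l) =
      Real.cos (normalAngle a b m - normalAngle a b l) := by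
  simp only [direction, form_add_right, form_smul_right, form_add_left, form_smul_left,
    F.form_a_a, F.form_b_b, F.form_a_b, form_comm b a, Real.cos_sub]
  ring

/-- At a point of the section, the normal of a crossing face makes a small angle with the
transported direction of its projection. -/
theorem le_form_transport (F : SectionFrame X S n o T p a b) {m y : Vec}
    (hm : m ∈ crossing X S n) (hy : y ∈ X) (hny : form n y = 0) (hmy : form m y = 0) :
    T ^ 2 * Real.sqrt (2 - T ^ 2) ≤ form m (transport p y (direction a b m)) := by
  have hys := F.pres.subset_space hy
  have hC1 := one_le_neg_form F.mem_space hys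
  have hC2 := F.isFar.sq_mul_neg_form_le F.pres F.mem F.form_n_p hy hny
  have hκ := form_sq_le_of_crossing F.pres F.isFar hm
  have hr2 := F.sq_normalLength (mem_crossing.1 hm).1
  have hr := F.normalLength_pos hm
  have hT := F.isFar.pos
  have hT1 := F.isFar.lt_one
  have e1 : normalLength a b m * form y (direction a b m) = form p m * form p y := by
    have h := F.expand m y
    rw [hmy, hny, form_left_eq a b m, form_right_eq a b m] at h
    simp only [direction, form_add_right, form_smul_right, form_comm y a, form_comm y b]
    linarith
  have e2 : form m (direction a b m) = normalLength a b m := by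
    simp only [direction, form_add_right, form_smul_right, form_comm m a, form_comm m b,
      form_left_eq a b m, form_right_eq a b m]
    linear_combination normalLength a b m * Real.sin_sq_add_cos_sq (normalAngle a b m)
  set r := normalLength a b m
  set C := -form p y with hC
  have e3 : form m (transport p y (direction a b m)) * (r * (1 + C)) =
      r ^ 2 + C * (1 - form m n ^ 2) := by
    have h0 : 1 - form p y = 1 + C := by rw [hC]; ring
    have h1 : 1 + C ≠ 0 := by linarith
    have h2 : form y (direction a b m) = form p m * form p y / r := by
      rw [eq_div_iff hr.ne', mul_comm, e1]
    simp only [transport, form_add_right, form_smul_right, hmy, e2, h0, h2, form_comm m p]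
    field_simp
    rw [hr2, (by rw [hC]; ring : form p y = -C)]
    ring
  have hden : 0 < r * (1 + C) := mul_pos hr (by linarith)
  rw [← mul_le_mul_iff_left₀ hden, e3]
  have hT2 : T ^ 2 < 1 := by nlinarith
  have hs := Real.sq_sqrt (by linarith : 0 ≤ 2 - T ^ 2)
  apply le_of_sq_le_sq _ (by nlinarith [sq_nonneg r])
  have f1 : T ^ 2 * (2 - T ^ 2) * (1 + C) ^ 2 ≤ 4 * C := by
    have g1 : 0 ≤ 2 - T ^ 2 * (1 + C) := by linarith
    have g2 : 0 ≤ (2 - T ^ 2) * (1 + C) - 2 := by nlinarith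
    nlinarith [mul_nonneg g1 g2]
  -- the inequality between the arithmetic and the geometric mean
  calc (T ^ 2 * Real.sqrt (2 - T ^ 2) * (r * (1 + C))) ^ 2
      = T ^ 2 * r ^ 2 * (T ^ 2 * Real.sqrt (2 - T ^ 2) ^ 2 * (1 + C) ^ 2) := by ring
    _ = T ^ 2 * r ^ 2 * (T ^ 2 * (2 - T ^ 2) * (1 + C) ^ 2) := by rw [hs]
    _ ≤ T ^ 2 * r ^ 2 * (4 * C) := mul_le_mul_of_nonneg_left f1 (by positivity)
    _ ≤ 4 * r ^ 2 * (C * (1 - form m n ^ 2)) := by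
        nlinarith [mul_le_mul_of_nonneg_left (by linarith : T ^ 2 ≤ 1 - form m n ^ 2)
          (mul_nonneg (sq_nonneg r) (by linarith : 0 ≤ C))]
    _ ≤ (r ^ 2 + C * (1 - form m n ^ 2)) ^ 2 := by
        nlinarith [sq_nonneg (r ^ 2 - C * (1 - form m n ^ 2))]

/-- The angle between the normals of two crossing faces that share a point of the section, in
terms of the angle between their projections. -/
theorem arccos_form_le (F : SectionFrame X S n o T p a b) {m l y : Vec}
    (hm : m ∈ crossing X S n) (hl : l ∈ crossing X S n) (hy : y ∈ X) (hny : form n y = 0)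
    (hmy : form m y = 0) (hly : form l y = 0) :
    Real.arccos (form m l) ≤ Real.arccos (Real.cos (normalAngle a b m - normalAngle a b l)) +
      2 * Real.arccos (T ^ 2 * Real.sqrt (2 - T ^ 2)) := by
  have hys := F.pres.subset_space hy
  let E : Vec → Vec := fun m => transport p y (direction a b m)
  have hE : ∀ k, form y (E k) = 0 := fun k => form_transport F.mem_space hys
  have hEE : ∀ k j, form (E k) (E j) = Real.cos (normalAngle a b k - normalAngle a b j) :=
    fun k j => by
      rw [← F.form_direction k j]
      exact form_transport_transport F.mem_space hys (F.form_p_direction k) (F.form_p_direction j)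
  have hE1 : ∀ k, form (E k) (E k) = 1 := fun k => by rw [hEE, sub_self, Real.cos_zero]
  have um := F.pres.unit m (mem_crossing.1 hm).1
  have ul := F.pres.unit l (mem_crossing.1 hl).1
  have hym : form y m = 0 := by rw [form_comm, hmy]
  have hyl : form y l = 0 := by rw [form_comm, hly]
  have h1 := HypThree.arccos_form_le hys hym (hE m) hyl um (hE1 m) ul
  have h2 := HypThree.arccos_form_le hys (hE m) (hE l) hyl (hE1 m) (hE1 l) ul
  have h3 := Real.arccos_le_arccos (F.le_form_transport hm hy hny hmy)
  have h4 := Real.arccos_le_arccos (F.le_form_transport hl hy hny hly)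
  rw [form_comm l] at h4
  rw [hEE] at h2
  change Real.arccos (form m (E m)) ≤ _ at h3
  change Real.arccos (form (E l) l) ≤ _ at h4
  linarith

end SectionFrame

theorem arccos_lt_three_mul_exp {r : ℝ} (hr : 0 < r) (hq : 3 * Real.exp (-r) < Real.pi / 2) :
    Real.arccos (Real.tanh r ^ 2 * Real.sqrt (2 - Real.tanh r ^ 2)) < 3 * Real.exp (-r) := by
  have hq0 := Real.exp_pos (-r)
  have hT : Real.tanh r * (1 + Real.exp (-r) ^ 2) = 1 - Real.exp (-r) ^ 2 := by
    have h1 : Real.exp r * Real.exp (-r) = 1 := by rw [← Real.exp_add]; simp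
    have h2 := Real.exp_pos r
    rw [Real.tanh_eq, div_mul_eq_mul_div, div_eq_iff (by positivity)]
    linear_combination (2 * Real.exp (-r)) * h1
  set q := Real.exp (-r)
  set T := Real.tanh r
  have hT0 : 0 < T := by
    simp only [T, Real.tanh_eq_sinh_div_cosh]
    exact div_pos (Real.sinh_pos_iff.2 hr) (Real.cosh_pos r)
  have hT1 : T < 1 := Real.tanh_lt_one r
  have hT2 : T ^ 2 < 1 := by nlinarith
  have hs := Real.sq_sqrt (by linarith : 0 ≤ 2 - T ^ 2)
  set Γ := T ^ 2 * Real.sqrt (2 - T ^ 2)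
  have hΓ0 : 0 ≤ Γ := by positivity
  have hΓ : Γ ^ 2 = T ^ 4 * (2 - T ^ 2) := by simp only [Γ, mul_pow, hs]; ring
  have hΓ1 : Γ ≤ 1 := by
    have : Γ ^ 2 ≤ 1 := by
      rw [hΓ]
      nlinarith [mul_nonneg (by linarith : 0 ≤ 1 - T ^ 2)
        (by nlinarith [sq_nonneg T] : 0 ≤ 1 + T ^ 2 - T ^ 2 * T ^ 2)]
    nlinarith
  -- it suffices to compare the sines of the two angles
  suffices hcos : Real.cos (3 * q) < Γ by
    by_contra hcon
    push Not at hcon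
    have := Real.cos_le_cos_of_nonneg_of_le_pi (by positivity) (Real.arccos_le_pi Γ) hcon
    rw [Real.cos_arccos (by linarith) hΓ1] at this
    linarith
  apply lt_of_pow_lt_pow_left₀ 2 hΓ0
  have hpi := Real.pi_lt_d4
  have hq1 : q < 0.5236 := by linarith
  have hsin := Real.sin_gt_sub_cube (by positivity : 0 < 3 * q)
  have hsc := Real.sin_sq_add_cos_sq (3 * q)
  set v := q ^ 2 with hv
  have hv0 : 0 < v := by positivity
  have hv1 : v < 0.27416 := by nlinarith
  have hsin2 : 9 * v * (1 - 1.5 * v) ^ 2 < Real.sin (3 * q) ^ 2 := by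
    have h1 : 0 ≤ 3 * q * (1 - 1.5 * v) := mul_nonneg (by positivity) (by linarith)
    have h2 : 3 * q * (1 - 1.5 * v) < Real.sin (3 * q) := by
      have : 3 * q - (3 * q) ^ 3 / 6 = 3 * q * (1 - 1.5 * v) := by rw [hv]; ring
      linarith
    have h3 := pow_lt_pow_left₀ h2 h1 two_ne_zero
    have h4 : (3 * q * (1 - 1.5 * v)) ^ 2 = 9 * v * (1 - 1.5 * v) ^ 2 := by rw [hv]; ring
    linarith
  have hTs : (1 - T ^ 2) * (1 + v) ^ 2 = 4 * v := by
    linear_combination (-(T * (1 + v)) - (1 - v)) * hT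
  have hmain : 5 * v ≤ 9 * v * (1 - 1.5 * v) ^ 2 * (1 + v) ^ 2 := by
    have h1 : 0.75 ≤ (1 - 1.5 * v) * (1 + v) := by nlinarith
    have h2 : 5 / 9 ≤ ((1 - 1.5 * v) * (1 + v)) ^ 2 :=
      le_trans (by norm_num) (pow_le_pow_left₀ (by norm_num) h1 2)
    have h3 := mul_le_mul_of_nonneg_left h2 hv0.le
    have h4 : 9 * v * (1 - 1.5 * v) ^ 2 * (1 + v) ^ 2 =
        9 * (v * ((1 - 1.5 * v) * (1 + v)) ^ 2) := by ring
    linarith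
  have hb : 1 - T ^ 4 * (2 - T ^ 2) ≤ 5 / 4 * (1 - T ^ 2) := by
    nlinarith [mul_nonneg (by linarith : 0 ≤ 1 - T ^ 2) (sq_nonneg (1 / 2 - T ^ 2))]
  have hfin : 5 / 4 * (1 - T ^ 2) ≤ 9 * v * (1 - 1.5 * v) ^ 2 := by
    have h1 : 0 < (1 + v) ^ 2 := by positivity
    refine le_of_mul_le_mul_right ?_ h1
    linarith
  rw [hΓ]
  linarith

namespace IsPresentation

theorem exteriorDihedralAngle_facets {X : Set Vec} {S : Finset Vec} (h : IsPresentation X S)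
    {m l : Vec} (hm : m ∈ S) (hl : l ∈ S) :
    exteriorDihedralAngle X (faceSet X {m}) (faceSet X {l}) = Real.arccos (form m l) := by
  rw [exteriorDihedralAngle, h.outwardNormal_facet hm, h.outwardNormal_facet hl]

end IsPresentation

namespace SectionFrame

variable {X : Set Vec} {S : Finset Vec} {n o p a b : Vec} {T : ℝ} {k : ℕ}
  {σ : ℕ → crossing X S n} {φ : ℕ → ℝ}

/-- Consecutive faces along the section share a point of the section at which no other inequality
is tight. -/
theorem exists_point (F : SectionFrame X S n o T p a b)
    (hc : IsCyclicOrder (fun m : crossing X S n => normalAngle a b m) k σ φ) (i : ℕ) :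
    ∃ y ∈ X, form n y = 0 ∧ form (σ i) y = 0 ∧ form (σ (i + 1)) y = 0 ∧
      ∀ l ∈ S, l ≠ (σ i : Vec) → l ≠ (σ (i + 1) : Vec) → form l y < 0 := by
  obtain ⟨s, t, h1, h2, h3⟩ := hc.exists_corner F.isPolygon i
  exact F.exists_corner_point h1 h2 h3

/-- The dihedral angles along the section exceed the turning angles of the projected normals by
a small amount. -/
theorem arccos_consecutive_le (F : SectionFrame X S n o T p a b)
    (hc : IsCyclicOrder (fun m : crossing X S n => normalAngle a b m) k σ φ) (i : ℕ) :
    Real.arccos (form (σ i) (σ (i + 1))) ≤ φ (i + 1) - φ i +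
      2 * Real.arccos (T ^ 2 * Real.sqrt (2 - T ^ 2)) := by
  obtain ⟨y, hy, hny, h1, h2, -⟩ := F.exists_point hc i
  have h := F.arccos_form_le (σ i).2 (σ (i + 1)).2 hy hny h1 h2
  have hcos : Real.cos (normalAngle a b (σ i) - normalAngle a b (σ (i + 1))) =
      Real.cos (φ (i + 1) - φ i) := by
    rw [Real.cos_sub, Real.cos_sub, hc.cos_eq, hc.cos_eq, hc.sin_eq, hc.sin_eq]
    ring
  rw [hcos, Real.arccos_cos (by linarith [hc.mono (Nat.lt_succ_self i)])
    (hc.gap_lt_pi F.isPolygon i).le] at h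
  exact h

/-- An edge that meets the plane is the intersection of two consecutive faces. -/
theorem exists_eq_inter (F : SectionFrame X S n o T p a b)
    (hc : IsCyclicOrder (fun m : crossing X S n => normalAngle a b m) k σ φ)
    {d : Set Vec} (hd : IsEdge X d) (hdn : (d ∩ plane n).Nonempty) :
    ∃ i < k, d = faceSet X {(σ i : Vec)} ∩ faceSet X {(σ (i + 1) : Vec)} := by
  obtain ⟨m, hm, l, hl, hne, rfl⟩ := F.pres.exists_faces_of_isEdge hd
  obtain ⟨y, ⟨⟨hy, hmy⟩, -, hly⟩, hys, hny⟩ := hdn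
  have hmy := hmy m rfl
  have hly := hly l rfl
  have hmc := F.pres.mem_crossing_of hm hy hmy hny
  have hlc := F.pres.mem_crossing_of hl hy hly hny
  have hpy := form_neg_of_space F.mem_space hys
  have hpos : ∀ j ∈ crossing X S n, 0 < normalLength a b j * -form p y := fun j hj =>
    mul_pos (F.normalLength_pos hj) (neg_pos.2 hpy)
  have htight : ∀ j ∈ crossing X S n, form j y = 0 →
      dirForm (normalAngle a b j) (form a y / -form p y) (form b y / -form p y) =
        offset p a b j := by
    intro j hj h0
    rw [F.form_eq hj hny hpy] at h0
    exact sub_eq_zero.1 ((mul_eq_zero.1 h0).resolve_left (hpos j hj).ne')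
  obtain ⟨i, hi, h | h⟩ := hc.exists_consecutive F.isPolygon
    (l := ⟨m, hmc⟩) (m := ⟨l, hlc⟩) (fun h0 => hne (congrArg Subtype.val h0))
    (p := form a y / -form p y) (q := form b y / -form p y)
    (fun j => by
      have h1 := F.pres.form_nonpos (mem_crossing.1 j.2).1 hy
      rw [F.form_eq j.2 hny hpy] at h1
      exact sub_nonpos.1 (nonpos_of_mul_nonpos_right h1 (hpos j j.2)))
    (htight m hmc hmy) (htight l hlc hly)
  · exact ⟨i, hi, by rw [h.1, h.2]⟩
  · exact ⟨i, hi, by rw [h.1, h.2, Set.inter_comm]⟩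

end SectionFrame

end HypThree

end

open HypThree

theorem mainTheorem4 :
    ∃ ρ₀ : ℝ, ∀ (X : Set HypThree.Vec) (N : ℕ) (ρ : ℝ),
      HypThree.IsConvexPolyhedron X →
      (HypThree.vertices X).ncard = N →
      HypThree.hdiam X = ρ →
      ρ₀ < ρ →
      -- a diameter `[u, v]` of `X` and a plane with unit normal `n`
      ∃ u ∈ X, ∃ v ∈ X, ∃ n : HypThree.Vec, HypThree.form n n = 1 ∧
        HypThree.hdist u v = ρ ∧
        -- the plane is orthogonal to the line `uv` and separates `u` from `v`
        n ∈ Submodule.span ℝ {u, v} ∧ HypThree.form n u < 0 ∧ 0 < HypThree.form n v ∧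
        -- and stays far from all the vertices
        (∀ w ∈ HypThree.vertices X, ∀ y ∈ HypThree.plane n, ρ / (2 * N) ≤ HypThree.hdist w y) ∧
        -- the cyclic sequence of faces (indices modulo `k`), with the edges `e i`
        ∃ (k : ℕ) (F e : ℕ → Set HypThree.Vec), 3 ≤ k ∧
          (∀ i, F (i + k) = F i) ∧
          Set.InjOn F (Set.Iio k) ∧
          (∀ i, HypThree.IsFace X (F i)) ∧
          (∀ i, HypThree.IsEdge X (e i) ∧ e i = F i ∩ F (i + 1)) ∧
          -- they are precisely the faces and the edges that cross the plane
          (∀ G, HypThree.IsFace X G → ((G ∩ HypThree.plane n).Nonempty ↔ ∃ i < k, G = F i)) ∧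
          (∀ d, HypThree.IsEdge X d → ((d ∩ HypThree.plane n).Nonempty ↔ ∃ i < k, d = e i)) ∧
          ∑ i ∈ Finset.range k, HypThree.exteriorDihedralAngle X (F i) (F (i + 1)) <
            2 * Real.pi + 12 * N * Real.exp (-ρ / (2 * N)) := by
  refine ⟨0, fun X N ρ hX hN hdiam hρ => ?_⟩
  obtain ⟨S, h⟩ := hX.exists_presentation
  obtain ⟨u, hu, v, hv, huv⟩ := h.exists_hdist_eq_hdiam
  rw [hdiam] at huv
  obtain ⟨n, o, hP, hspan, hnu, hnv, hNpos⟩ := h.exists_isFarPlane hu hv huv hρ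
  rw [hN] at hP hNpos
  obtain ⟨p, hp, hnp, hint⟩ := h.exists_interior_section hu hv hnu hnv
  obtain ⟨a, b, hpa, hpb, hna, hnb, haa, hbb, hab, hexp⟩ :=
    exists_frame (h.subset_space hp) hP.unit (by rw [form_comm]; exact hnp)
  have F : SectionFrame X S n o _ p a b :=
    ⟨h, hP, hp, hnp, hint, hpa, hpb, hna, hnb, haa, hbb, hab, hexp⟩
  have hne := F.nonempty_crossing
  obtain ⟨σ, φ, hc⟩ := F.isPolygon.exists_isCyclicOrder
  set k := Fintype.card (crossing X S n) with hk
  have hσ : ∀ i, (σ i : Vec) ∈ S := fun i => (mem_crossing.1 (σ i).2).1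
  have hN0 : (0 : ℝ) < N := by exact_mod_cast hNpos
  have hr : 0 < ρ / (2 * N) := by positivity
  have hk3 := hc.three_le F.isPolygon
  have hkN : k ≤ 2 * N := by
    rw [hk, Fintype.card_coe, ← hN]
    exact (Finset.card_le_card fun m hm => (mem_crossing.1 hm).1).trans h.card_le
  have hkN' : (k : ℝ) ≤ 2 * N := by exact_mod_cast hkN
  have hk0 : (0 : ℝ) < k := by exact_mod_cast (by omega : 0 < k)
  refine ⟨u, hu, v, hv, n, hP.unit, huv, hspan, hnu, hnv,
    fun w hw y hy => hP.le_hdist h hr hw hy, k, fun i => faceSet X {(σ i : Vec)},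
    fun i => faceSet X {(σ i : Vec)} ∩ faceSet X {(σ (i + 1) : Vec)}, hk3,
    fun i => congrArg (fun m : crossing X S n => faceSet X {(m : Vec)}) (hc.period i), ?_,
    fun i => h.isFace_facet (hσ i), fun i => ⟨?_, rfl⟩,
    fun G hG => ⟨?_, ?_⟩, fun d hd => ⟨fun hdn => F.exists_eq_inter hc hd hdn, ?_⟩, ?_⟩
  · intro i hi j hj hij
    exact hc.injOn hi hj (Subtype.ext (h.facet_injOn (hσ i) (hσ j) hij))
  · obtain ⟨y, hy, -, h1, h2, h3⟩ := F.exists_point hc i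
    exact h.isEdge_inter (hσ i) (hσ (i + 1))
      (fun h0 => hc.apply_ne (Nat.lt_succ_self i) (by omega) (Subtype.ext h0)) hy h1 h2 h3
  · rintro ⟨y, hyG, hys, hny⟩
    obtain ⟨m, hm, rfl⟩ := h.exists_facet_of_isFace hG
    obtain ⟨i, hi, hσi⟩ := hc.surj ⟨m, h.mem_crossing_of hm hyG.1 (hyG.2 m rfl) hny⟩
    exact ⟨i, hi, (congrArg (fun m : crossing X S n => faceSet X {(m : Vec)}) hσi).symm⟩
  · rintro ⟨i, -, rfl⟩
    obtain ⟨y, hy, hny, h1, -⟩ := F.exists_point hc i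
    exact ⟨y, ⟨hy, by simpa using h1⟩, h.subset_space hy, hny⟩
  · rintro ⟨i, -, rfl⟩
    obtain ⟨y, hy, hny, h1, h2, -⟩ := F.exists_point hc i
    exact ⟨y, ⟨⟨hy, by simpa using h1⟩, hy, by simpa using h2⟩, h.subset_space hy, hny⟩
  · simp only [h.exteriorDihedralAngle_facets (hσ _) (hσ _), neg_div]
    have hq := Real.exp_pos (-(ρ / (2 * N)))
    have hpi := Real.pi_pos
    rcases le_or_gt (Real.pi / 2) (3 * Real.exp (-(ρ / (2 * N)))) with hbig | hsmall
    · -- if the exponential is not small, it suffices that no angle exceeds `π`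
      calc ∑ i ∈ Finset.range k, Real.arccos (form (σ i) (σ (i + 1)))
          ≤ ∑ i ∈ Finset.range k, Real.pi := Finset.sum_le_sum fun i _ => Real.arccos_le_pi _
        _ = k * Real.pi := by rw [Finset.sum_const, Finset.card_range, nsmul_eq_mul]
        _ ≤ 2 * N * Real.pi := mul_le_mul_of_nonneg_right hkN' hpi.le
        _ < 2 * Real.pi + 12 * N * Real.exp (-(ρ / (2 * N))) := by
          nlinarith [mul_le_mul_of_nonneg_left hbig hN0.le]
    · have hγ := arccos_lt_three_mul_exp hr hsmall
      set γ := Real.arccos (Real.tanh (ρ / (2 * N)) ^ 2 *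
        Real.sqrt (2 - Real.tanh (ρ / (2 * N)) ^ 2))
      have hturn : φ k = φ 0 + 2 * Real.pi := by simpa using hc.lift 0
      calc ∑ i ∈ Finset.range k, Real.arccos (form (σ i) (σ (i + 1)))
          ≤ ∑ i ∈ Finset.range k, (φ (i + 1) - φ i + 2 * γ) :=
            Finset.sum_le_sum fun i _ => F.arccos_consecutive_le hc i
        _ = 2 * Real.pi + k * (2 * γ) := by
            rw [Finset.sum_add_distrib, Finset.sum_range_sub, Finset.sum_const,
              Finset.card_range, nsmul_eq_mul, hturn]
            ring
        _ < 2 * Real.pi + k * (6 * Real.exp (-(ρ / (2 * N)))) := by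
            have := mul_lt_mul_of_pos_left (by linarith :
              2 * γ < 6 * Real.exp (-(ρ / (2 * N)))) hk0
            linarith
        _ ≤ 2 * Real.pi + 12 * N * Real.exp (-(ρ / (2 * N))) := by
            nlinarith [mul_le_mul_of_nonneg_right hkN' hq.le]
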